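/- Let $q$ be a prime power and let $X$ be the Hermitian curve $y^q+y=x^{q+1}$ over $\mathbb{F}_{q^2}$, with genus $g$ ($=q(q-1)/2$), point at infinity $P_\infty$ and origin $P_0$. For a divisor $G$ on $X$ let $L(G)$ be the $\mathbb{F}_{q^2}$-vector space of rational functions $f$ on $X$ over $\mathbb{F}_{q^2}$ with $f=0$ or $(f)+G\ge 0$. For $a,b\in\mathbb{Z}$ let $M_{P_\infty}(a,b)$ be the set of pairs $(f,h)$ of rational functions such that $fh\in L(aP_\infty+bP_0)\setminus L((a-1)P_\infty+bP_0)$, $f\in L(aP_\infty+bP_0)$ and $h\in L((a+b)P_\infty)$, and put $$m_{P_\infty}(a,b)=\#\{-b\le i\le a+1:\ \exists (f,h)\in M_{P_\infty}(a+1,b)\text{ with }\operatorname{ord}_{P_\infty}(f)=-i\}.$$ Similarly, let $M_{P_0}(a,b)$ be the set of pairs $(f,h)$ with $fh\in L(aP_\infty+bP_0)\setminus L(aP_\infty+(b-1)P_0)$, $f\in L(aP_\infty+bP_0)$ and $h\in L((a+b)P_0)$, and put $$m_{P_0}(a,b)=\#\{-a\le j\le b+1:\ \exists (f,h)\in M_{P_0}(a,b+1)\text{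 with }\operatorname{ord}_{P_0}(f)=-j\}.$$ Let $a=a_0(q+1)-a_1$ and $b=b_0(q+1)-b_1$ with $a_0,a_1,b_0,b_1\in\mathbb{Z}$, $0\le a_1\le q$ and $0\le b_1\le q$. Then: 1. if $a_1<a_0+b_0$, then $m_{P_\infty}(2g-2+a,b)=(a_0+b_0-a_1)(q+1)-b_1+a_1q$; 2. if $a_0+b_0\le a_1\le a_0+b_0+q-1$, then $m_{P_\infty}(2g-2+a,b)=a_1(q+a_0+b_0-a_1)-\min\{a_1,b_1\}$; 3. if $a_0+b_0+q-1<a_1$, then $m_{P_\infty}(2g-2+a,b)=0$; 4. if $b_1<a_0+b_0$, then $m_{P_0}(2g-2+a,b)=(a_0+b_0-b_1)(q+1)-a_1+b_1q$; 5. if $a_0+b_0\le b_1\le a_0+b_0+q-1$, then $m_{P_0}(2g-2+a,b)=b_1(q+a_0+b_0-b_1)-\min\{a_1,b_1\}$; 6. if $a_0+b_0+q-1<b_1$, then $m_{P_0}(2g-2+a,b)=0$. -/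

import Mathlib

open Polynomial

set_option linter.unusedSectionVars false

noncomputable section

/-! ### Places, divisors and Riemann-Roch spaces of a function field `F / K` -/

section Places

variable (K F : Type*) [Field K] [Field F] [Algebra K F]

/-- A place of `F / K`, given by its normalized discrete valuation: a surjective valuation
`F → ℤ ∪ {0}` (written multiplicatively) that is trivial on the constants. -/
@[ext]
structure Place where
  /-- the normalized valuation of the place -/
  val : Valuation F (WithZero (Multiplicative ℤ))
  surjective : Function.Surjective val
  trivial_on_constants : ∀ c : K, c ≠ 0 → val (algebraMap K F c) = 1

variable {K F}

/-- The order `ord_P(f)` of a nonzero function `f` at the place `P`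
(with the value `0` at `f = 0`, which is never used). -/
def Place.ord (P : Place K F) (f : F) : ℤ := -WithZero.log (P.val f)

theorem Place.val_ne_zero (P : Place K F) {f : F} (hf : f ≠ 0) : P.val f ≠ 0 :=
  (Valuation.ne_zero_iff _).2 hf

theorem Place.val_le_one (P : Place K F) (c : K) : P.val (algebraMap K F c) ≤ 1 := by
  by_cases hc : c = 0
  · simp [hc]
  · exact (P.trivial_on_constants c hc).le

theorem Place.ord_nonneg_iff (P : Place K F) {f : F} (hf : f ≠ 0) (n : ℤ) :
    0 ≤ P.ord f + n ↔ P.val f ≤ WithZero.exp n := by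
  rw [← WithZero.log_le_iff_le_exp (P.val_ne_zero hf), Place.ord]
  omega

variable (K F) in
/-- Divisors: finite formal integer combinations of places. -/
abbrev Divisor := Place K F →₀ ℤ

theorem riemannRoch_mem_iff (G : Divisor K F) (f : F) :
    (f = 0 ∨ ∀ P : Place K F, 0 ≤ P.ord f + G P) ↔
      ∀ P : Place K F, P.val f ≤ WithZero.exp (G P) := by
  by_cases hf : f = 0
  · simp [hf]
  · simp only [hf, false_or]
    exact forall_congr' fun P => P.ord_nonneg_iff hf _

/-- The Riemann-Roch space `L(G)`: the zero function together with all functions `f ≠ 0` such that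
`(f) + G ≥ 0`. -/
def riemannRoch (G : Divisor K F) : Submodule K F where
  carrier := {f | f = 0 ∨ ∀ P : Place K F, 0 ≤ P.ord f + G P}
  zero_mem' := Or.inl rfl
  add_mem' {f g} hf hg := by
    simp only [Set.mem_ofPred_eq, riemannRoch_mem_iff] at hf hg ⊢
    exact fun P => (P.val.map_add f g).trans (max_le (hf P) (hg P))
  smul_mem' c f hf := by
    simp only [Set.mem_ofPred_eq, riemannRoch_mem_iff] at hf ⊢
    intro P
    rw [Algebra.smul_def, map_mul]
    exact (mul_le_mul' (P.val_le_one c) (hf P)).trans (one_mul _).le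

/-- The space of functions that are regular at every place outside `S`. -/
def regularOutside (S : Set (Place K F)) : Submodule K F where
  carrier := {f | ∀ P : Place K F, P ∉ S → P.val f ≤ 1}
  zero_mem' := fun P _ => by simp
  add_mem' {f g} hf hg := fun P hP =>
    (P.val.map_add f g).trans (max_le (hf P hP) (hg P hP))
  smul_mem' c f hf := fun P hP => by
    rw [Algebra.smul_def, map_mul]
    exact (mul_le_mul' (P.val_le_one c) (hf P hP)).trans (one_mul _).le

/-- The genus `dim_K H¹(X, 𝒪)` of the smooth projective curve `X` with function field `F / K`,
where `H¹` is the Čech cohomology of the affine covering `X = (X ∖ P) ∪ (X ∖ Q)` given by two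
points `P ≠ Q`, that is, the cokernel of the difference map
`𝒪(X ∖ P) ⊕ 𝒪(X ∖ Q) → 𝒪(X ∖ {P, Q})`. -/
def cechGenus (P Q : Place K F) : ℕ :=
  Module.finrank K
    (regularOutside {P, Q} ⧸
      (regularOutside {P} ⊔ regularOutside {Q}).comap (regularOutside {P, Q}).subtype)

/-- The divisor `a P + b Q`. -/
def twoPoint (P : Place K F) (a : ℤ) (Q : Place K F) (b : ℤ) : Divisor K F :=
  Finsupp.single P a + Finsupp.single Q b

/-- For two places `P ≠ Q`, the set `M_P` of pairs `(f, g)` for the divisor `a P + b Q`: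
`f g ∈ L(a P + b Q) ∖ L((a - 1) P + b Q)`, `f ∈ L(a P + b Q)` and `g ∈ L((a + b) P)`. -/
def multPairs (P : Place K F) (a : ℤ) (Q : Place K F) (b : ℤ) : Set (F × F) :=
  {p | p.1 * p.2 ∈ riemannRoch (twoPoint P a Q b) ∧
    p.1 * p.2 ∉ riemannRoch (twoPoint P (a - 1) Q b) ∧
    p.1 ∈ riemannRoch (twoPoint P a Q b) ∧
    p.2 ∈ riemannRoch (Finsupp.single P (a + b))}

/-- For two places `P ≠ Q`, the multiplicity `m_P` for the divisor `a P + b Q`: the number of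
`-b ≤ i ≤ a + 1` that occur as the pole order at `P` of the first member of a pair in `M_P` for the
divisor `(a + 1) P + b Q`. -/
def multiplicityAt (P : Place K F) (a : ℤ) (Q : Place K F) (b : ℤ) : ℕ :=
  Set.ncard {i : ℤ | -b ≤ i ∧ i ≤ a + 1 ∧
    ∃ f g : F, (f, g) ∈ multPairs P (a + 1) Q b ∧ P.ord f = -i}

end Places

/-! ### The Hermitian curve `y ^ q + y = x ^ (q + 1)` over the field `K` with `q ^ 2` elements -/

namespace Hermitian

/-- The polynomial `x ^ (q + 1) - (y ^ q + y)` in `K[y][x]`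
(the inner variable is `y`, the outer one is `x`). -/
def poly (K : Type*) [Field K] (q : ℕ) : K[X][X] :=
  X ^ (q + 1) - C (X ^ q + X)

/-- The affine coordinate ring `K[x, y] / (y ^ q + y - x ^ (q + 1))`. -/
abbrev CoordRing (K : Type*) [Field K] (q : ℕ) : Type _ := AdjoinRoot (poly K q)

/-- The function field of the Hermitian curve. -/
abbrev FunField (K : Type*) [Field K] (q : ℕ) : Type _ := FractionRing (CoordRing K q)

variable (K : Type*) [Field K] (q : ℕ)

/-- The coordinate function `x` on the affine curve. -/
def cx : CoordRing K q := AdjoinRoot.root (poly K q)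

/-- The coordinate function `y` on the affine curve. -/
def cy : CoordRing K q := AdjoinRoot.of (poly K q) X

theorem coord_equation : cy K q ^ q + cy K q = cx K q ^ (q + 1) := by
  have h : AdjoinRoot.mk (poly K q) (poly K q) = 0 := AdjoinRoot.mk_self
  have e : AdjoinRoot.mk (poly K q) (poly K q) =
      AdjoinRoot.mk (poly K q) (X ^ (q + 1) - C (X ^ q + X)) := rfl
  rw [e, map_sub, sub_eq_zero, map_pow, AdjoinRoot.mk_X, AdjoinRoot.mk_C, map_add, map_pow] at h
  exact h.symm

theorem poly_monic : (poly K q).Monic := by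
  unfold poly
  exact monic_X_pow_sub_C _ (by omega)

theorem poly_prime (hq : 2 ≤ q) : Prime (poly K q) := by
  rw [← irreducible_iff_prime]
  have hP : (Ideal.span {(X : K[X])}).IsPrime :=
    (Ideal.span_singleton_prime X_ne_zero).2 prime_X
  have hd : (poly K q).degree = (q + 1 : ℕ) := by
    unfold poly
    exact degree_X_pow_sub_C (by omega) _
  refine irreducible_of_eisenstein_criterion hP ?_ ?_ ?_ ?_ (poly_monic K q).isPrimitive
  · rw [(poly_monic K q).leadingCoeff]
    exact fun h => hP.ne_top ((Ideal.eq_top_iff_one _).2 h)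
  · intro n hn
    rw [hd, Nat.cast_lt] at hn
    rw [Ideal.mem_span_singleton]
    unfold poly
    rw [coeff_sub, coeff_X_pow, if_neg (by omega), zero_sub, dvd_neg, coeff_C]
    split_ifs
    · exact dvd_add (dvd_pow_self _ (by omega)) dvd_rfl
    · exact dvd_zero _
  · rw [hd]; exact_mod_cast Nat.succ_pos q
  · rw [Ideal.span_singleton_pow, Ideal.mem_span_singleton]
    unfold poly
    rw [coeff_sub, coeff_X_pow, if_neg (by omega), zero_sub, dvd_neg, coeff_C_zero,
      X_pow_dvd_iff]
    intro h
    have := h 1 (by omega)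
    rw [coeff_add, coeff_X_pow, if_neg (by omega), coeff_X_one] at this
    simp at this

theorem cy_ne_zero : cy K q ≠ 0 := by
  intro h
  have hd : (poly K q).degree ≠ 0 := by
    unfold poly
    rw [degree_X_pow_sub_C (by omega)]
    exact_mod_cast Nat.succ_ne_zero q
  have := AdjoinRoot.of.injective_of_degree_ne_zero hd
  exact X_ne_zero (this (h.trans (map_zero _).symm))

theorem two_le (K : Type*) [Field K] [Finite K] (q : ℕ) [hq : Fact (Nat.card K = q ^ 2)] :
    2 ≤ q := by
  have h1 : 1 < Nat.card K := Finite.one_lt_card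
  rw [hq.out] at h1
  by_contra h
  interval_cases q <;> simp at h1

variable [Finite K] [Fact (Nat.card K = q ^ 2)]

instance : IsDomain (CoordRing K q) :=
  AdjoinRoot.isDomain_of_prime (poly_prime K q (two_le K q))

/-- The function `x` in the function field. -/
def fx : FunField K q := algebraMap (CoordRing K q) (FunField K q) (cx K q)

/-- The function `y` in the function field. -/
def fy : FunField K q := algebraMap (CoordRing K q) (FunField K q) (cy K q)

theorem fy_ne_zero : fy K q ≠ 0 := fun h =>
  cy_ne_zero K q ((IsFractionRing.injective (CoordRing K q) (FunField K q))
    (h.trans (map_zero _).symm))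

theorem fun_equation : fy K q ^ q + fy K q = fx K q ^ (q + 1) := by
  simp only [fx, fy, ← map_pow, ← map_add, coord_equation]

/-- Evaluation of regular functions at the origin. -/
def evalOrigin : CoordRing K q →+* K :=
  AdjoinRoot.lift (evalRingHom 0) 0 (by
    have := two_le K q
    rw [poly, eval₂_sub, eval₂_X_pow, eval₂_C, coe_evalRingHom, eval_add, eval_pow, eval_X,
      zero_pow (by omega), zero_pow (by omega)]
    simp)

theorem evalOrigin_cx : evalOrigin K q (cx K q) = 0 := AdjoinRoot.lift_root _

theorem evalOrigin_cy : evalOrigin K q (cy K q) = 0 := by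
  simp [evalOrigin, cy]

theorem evalOrigin_algebraMap (c : K) : evalOrigin K q (algebraMap K (CoordRing K q) c) = c := by
  have : algebraMap K (CoordRing K q) c = AdjoinRoot.of (poly K q) (C c) := rfl
  rw [this, evalOrigin, AdjoinRoot.lift_of]
  simp

theorem mem_span_of_evalOrigin (r : CoordRing K q) (hr : evalOrigin K q r = 0) :
    r ∈ Ideal.span {cx K q, cy K q} := by
  have key : ∀ r : CoordRing K q,
      r - algebraMap K (CoordRing K q) (evalOrigin K q r) ∈ Ideal.span {cx K q, cy K q} := by
    intro r
    obtain ⟨p, rfl⟩ := AdjoinRoot.mk_surjective r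
    induction p using Polynomial.induction_on' with
    | add f g hf hg =>
      have := add_mem hf hg
      simp only [map_add]
      convert this using 1
      ring
    | monomial n f =>
      have e : AdjoinRoot.mk (poly K q) (monomial n f)
          = AdjoinRoot.of (poly K q) f * cx K q ^ n := by
        rw [← C_mul_X_pow_eq_monomial, map_mul, map_pow]; rfl
      rw [e]
      rcases n with _ | n
      · simp only [pow_zero, mul_one]
        have h2 : f = C (f.eval 0) + X * f.divX := by
          rw [← coeff_zero_eq_eval_zero, add_comm, X_mul_divX_add]
        have h3 : evalOrigin K q (AdjoinRoot.of (poly K q) f) = f.eval 0 := by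
          rw [evalOrigin, AdjoinRoot.lift_of]; rfl
        rw [h3]
        have h4 : AdjoinRoot.of (poly K q) f - algebraMap K (CoordRing K q) (f.eval 0)
            = cy K q * AdjoinRoot.of (poly K q) f.divX := by
          conv_lhs => rw [h2]
          simp only [map_add, map_mul, eval_add, eval_C, eval_mul, eval_X, zero_mul, add_zero]
          rw [show algebraMap K (CoordRing K q) (f.eval 0)
            = AdjoinRoot.of (poly K q) (C (f.eval 0)) from rfl, cy]
          ring
        rw [h4]
        exact Ideal.mul_mem_right _ _ (Ideal.subset_span (by simp))
      · rw [map_mul, map_pow, evalOrigin_cx]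
        simp only [ne_eq, Nat.add_eq_zero_iff, one_ne_zero, and_false, not_false_eq_true, zero_pow,
          mul_zero, map_zero, sub_zero]
        rw [pow_succ, ← mul_assoc]
        exact Ideal.mul_mem_left _ _ (Ideal.subset_span (by simp))
  simpa [hr] using key r

/-- The maximal ideal of the origin. -/
def originIdeal : Ideal (CoordRing K q) := RingHom.ker (evalOrigin K q)

instance : (originIdeal K q).IsPrime := RingHom.ker_isPrime _

theorem originIdeal_eq : originIdeal K q = Ideal.span {cx K q, cy K q} := by
  apply le_antisymm
  · exact fun r hr => mem_span_of_evalOrigin K q r hr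
  · rw [Ideal.span_le]
    rintro r (rfl | rfl)
    · exact evalOrigin_cx K q
    · exact evalOrigin_cy K q

instance : IsNoetherianRing (CoordRing K q) :=
  inferInstanceAs (IsNoetherianRing (K[X][X] ⧸ Ideal.span {poly K q}))

/-- The local ring of the curve at the origin. -/
abbrev OriginLocal : Type _ := Localization.AtPrime (originIdeal K q)

instance : IsDomain (OriginLocal K q) :=
  IsLocalization.isDomain_of_le_nonZeroDivisors _ (originIdeal K q).primeCompl_le_nonZeroDivisors

instance : IsNoetherianRing (OriginLocal K q) :=
  IsLocalization.isNoetherianRing (originIdeal K q).primeCompl _ inferInstance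

theorem maximalIdeal_eq : IsLocalRing.maximalIdeal (OriginLocal K q) =
    Ideal.span {algebraMap (CoordRing K q) (OriginLocal K q) (cx K q)} := by
  have hq := two_le K q
  rw [← Localization.AtPrime.map_eq_maximalIdeal]
  conv_lhs => rw [show Ideal.map (algebraMap (CoordRing K q) (OriginLocal K q)) (originIdeal K q) =
    Ideal.map (algebraMap (CoordRing K q) (OriginLocal K q)) (Ideal.span {cx K q, cy K q}) from
    congrArg _ (originIdeal_eq K q), Ideal.map_span, Set.image_pair]
  apply le_antisymm
  · rw [Ideal.span_le]
    rintro r (rfl | rfl)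
    · exact Ideal.subset_span rfl
    · rw [SetLike.mem_coe, Ideal.mem_span_singleton]
      have hu : IsUnit (algebraMap (CoordRing K q) (OriginLocal K q) (cy K q ^ (q - 1) + 1)) := by
        apply IsLocalization.map_units (OriginLocal K q)
          (⟨_, ?_⟩ : (originIdeal K q).primeCompl)
        intro h
        have h' : evalOrigin K q (cy K q ^ (q - 1) + 1) = 0 := h
        rw [map_add, map_pow, evalOrigin_cy, zero_pow (by omega)] at h'
        simp at h'
      rw [← hu.dvd_mul_right, ← map_mul]
      have : cy K q * (cy K q ^ (q - 1) + 1) = cx K q ^ (q + 1) := by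
        rw [← coord_equation, mul_add, mul_one, mul_pow_sub_one (by omega)]
      rw [this, map_pow]
      exact dvd_pow_self _ (by omega)
  · exact Ideal.span_mono (by simp)

theorem originLocal_not_isField : ¬ IsField (OriginLocal K q) := by
  rw [IsLocalRing.isField_iff_maximalIdeal_eq, ← ne_eq]
  intro h
  have hy : algebraMap (CoordRing K q) (OriginLocal K q) (cy K q) ∈
      IsLocalRing.maximalIdeal (OriginLocal K q) := by
    rw [← Localization.AtPrime.map_eq_maximalIdeal]
    exact Ideal.mem_map_of_mem _ (evalOrigin_cy K q)
  rw [h, Ideal.mem_bot] at hy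
  exact cy_ne_zero K q ((IsLocalization.injective _
    (originIdeal K q).primeCompl_le_nonZeroDivisors) (hy.trans (map_zero _).symm))

instance : IsDiscreteValuationRing (OriginLocal K q) :=
  ((IsDiscreteValuationRing.TFAE _ (originLocal_not_isField K q)).out 0 4 :
    IsDiscreteValuationRing (OriginLocal K q) ↔
      (IsLocalRing.maximalIdeal (OriginLocal K q)).IsPrincipal).2 ⟨_, maximalIdeal_eq K q⟩

/-- The valuation of the local ring at the origin. -/
def originVal : Valuation (FunField K q) (WithZero (Multiplicative ℤ)) :=
  (IsDiscreteValuationRing.maximalIdeal (OriginLocal K q)).valuation (FunField K q)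

theorem originVal_lt_one (r : CoordRing K q) (hr : evalOrigin K q r = 0) :
    originVal K q (algebraMap (CoordRing K q) (FunField K q) r) < 1 := by
  rw [IsScalarTower.algebraMap_apply (CoordRing K q) (OriginLocal K q) (FunField K q), originVal,
    IsDedekindDomain.HeightOneSpectrum.valuation_lt_one_iff_mem]
  change _ ∈ IsLocalRing.maximalIdeal (OriginLocal K q)
  rw [← Localization.AtPrime.map_eq_maximalIdeal]
  exact Ideal.mem_map_of_mem _ hr

theorem originVal_algebraMap (c : K) (hc : c ≠ 0) :
    originVal K q (algebraMap K (FunField K q) c) = 1 := by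
  have h : ∀ c : K, originVal K q (algebraMap K (FunField K q) c) ≤ 1 := fun c => by
    rw [IsScalarTower.algebraMap_apply K (CoordRing K q) (FunField K q),
      IsScalarTower.algebraMap_apply (CoordRing K q) (OriginLocal K q) (FunField K q), originVal]
    exact IsDedekindDomain.HeightOneSpectrum.valuation_le_one _ _
  refine le_antisymm (h c) ?_
  by_contra hlt
  rw [not_le] at hlt
  have h1 : originVal K q (algebraMap K (FunField K q) c) *
      originVal K q (algebraMap K (FunField K q) c⁻¹) = 1 := by
    rw [← map_mul, ← map_mul, mul_inv_cancel₀ hc, map_one, map_one]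
  have h2 := mul_lt_mul_of_lt_of_le_of_nonneg_of_pos hlt (h c⁻¹) zero_le zero_lt_one
  rw [h1, one_mul] at h2
  exact lt_irrefl _ h2

/-- The origin `P_0`, the point `x = y = 0`. -/
def pZero : Place K (FunField K q) where
  val := originVal K q
  surjective := IsDedekindDomain.HeightOneSpectrum.valuation_surjective _ _
  trivial_on_constants := originVal_algebraMap K q

theorem swap_equation : (fy K q)⁻¹ ^ q + (fy K q)⁻¹ = (fx K q / fy K q) ^ (q + 1) := by
  have h := fy_ne_zero K q
  rw [div_pow, ← fun_equation, inv_pow]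
  field_simp
  ring

/-- The substitution `x ↦ x / y`, `y ↦ 1 / y` on the affine coordinate ring. -/
def swapCoord : CoordRing K q →+* FunField K q :=
  AdjoinRoot.lift (aeval (fy K q)⁻¹ : K[X] →ₐ[K] FunField K q).toRingHom (fx K q / fy K q) (by
    change eval₂ _ _ (X ^ (q + 1) - C (X ^ q + X)) = 0
    rw [eval₂_sub, eval₂_X_pow, eval₂_C, ← swap_equation]
    simp)

theorem swapCoord_cx : swapCoord K q (cx K q) = fx K q / fy K q := AdjoinRoot.lift_root _

theorem swapCoord_cy : swapCoord K q (cy K q) = (fy K q)⁻¹ := by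
  simp [swapCoord, cy]

theorem swapCoord_algebraMap (c : K) :
    swapCoord K q (algebraMap K (CoordRing K q) c) = algebraMap K (FunField K q) c := by
  have : algebraMap K (CoordRing K q) c = AdjoinRoot.of (poly K q) (C c) := rfl
  rw [this, swapCoord, AdjoinRoot.lift_of]
  simp

theorem swapCoord_aux (a : CoordRing K q) : ∃ (n : ℕ) (b : CoordRing K q),
    swapCoord K q a * fy K q ^ n = algebraMap _ (FunField K q) b ∧
    swapCoord K q b * fy K q ^ n = algebraMap _ (FunField K q) a := by
  have hy := fy_ne_zero K q
  have hadd : ∀ a a' : CoordRing K q,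
      (∃ (n : ℕ) (b : CoordRing K q),
        swapCoord K q a * fy K q ^ n = algebraMap _ (FunField K q) b ∧
        swapCoord K q b * fy K q ^ n = algebraMap _ (FunField K q) a) →
      (∃ (n : ℕ) (b : CoordRing K q),
        swapCoord K q a' * fy K q ^ n = algebraMap _ (FunField K q) b ∧
        swapCoord K q b * fy K q ^ n = algebraMap _ (FunField K q) a') →
      (∃ (n : ℕ) (b : CoordRing K q),
        swapCoord K q (a + a') * fy K q ^ n = algebraMap _ (FunField K q) b ∧
        swapCoord K q b * fy K q ^ n = algebraMap _ (FunField K q) (a + a')) := by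
    rintro a a' ⟨n, b, h1, h2⟩ ⟨n', b', h1', h2'⟩
    refine ⟨n + n', b * cy K q ^ n' + b' * cy K q ^ n, ?_, ?_⟩
    · simp only [map_add, map_mul, map_pow, ← h1, ← h1']
      change _ = _ * fy K q ^ n' + _ * fy K q ^ n
      ring
    · simp only [map_add, map_mul, map_pow, ← h2, ← h2', swapCoord_cy, inv_pow]
      field_simp
      ring
  have hmul : ∀ a a' : CoordRing K q,
      (∃ (n : ℕ) (b : CoordRing K q),
        swapCoord K q a * fy K q ^ n = algebraMap _ (FunField K q) b ∧
        swapCoord K q b * fy K q ^ n = algebraMap _ (FunField K q) a) →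
      (∃ (n : ℕ) (b : CoordRing K q),
        swapCoord K q a' * fy K q ^ n = algebraMap _ (FunField K q) b ∧
        swapCoord K q b * fy K q ^ n = algebraMap _ (FunField K q) a') →
      (∃ (n : ℕ) (b : CoordRing K q),
        swapCoord K q (a * a') * fy K q ^ n = algebraMap _ (FunField K q) b ∧
        swapCoord K q b * fy K q ^ n = algebraMap _ (FunField K q) (a * a')) := by
    rintro a a' ⟨n, b, h1, h2⟩ ⟨n', b', h1', h2'⟩
    refine ⟨n + n', b * b', ?_, ?_⟩
    · simp only [map_mul, ← h1, ← h1']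
      ring
    · simp only [map_mul, ← h2, ← h2']
      ring
  have hx1 : ∃ (n : ℕ) (b : CoordRing K q),
      swapCoord K q (cx K q) * fy K q ^ n = algebraMap _ (FunField K q) b ∧
      swapCoord K q b * fy K q ^ n = algebraMap _ (FunField K q) (cx K q) := by
    refine ⟨1, cx K q, ?_, ?_⟩ <;>
    · rw [swapCoord_cx, pow_one, div_mul_cancel₀ _ hy]; rfl
  have hy1 : ∃ (n : ℕ) (b : CoordRing K q),
      swapCoord K q (cy K q) * fy K q ^ n = algebraMap _ (FunField K q) b ∧
      swapCoord K q b * fy K q ^ n = algebraMap _ (FunField K q) (cy K q) := by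
    refine ⟨1, 1, ?_, ?_⟩
    · rw [swapCoord_cy, pow_one, inv_mul_cancel₀ hy, map_one]
    · rw [map_one, one_mul, pow_one]; rfl
  have hc : ∀ c : K, ∃ (n : ℕ) (b : CoordRing K q),
      swapCoord K q (algebraMap K (CoordRing K q) c) * fy K q ^ n = algebraMap _ (FunField K q) b ∧
      swapCoord K q b * fy K q ^ n = algebraMap _ (FunField K q) (algebraMap K (CoordRing K q) c) := by
    intro c
    refine ⟨0, algebraMap K (CoordRing K q) c, ?_, ?_⟩ <;>
    · rw [pow_zero, mul_one, swapCoord_algebraMap]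
      exact IsScalarTower.algebraMap_apply K (CoordRing K q) (FunField K q) c
  obtain ⟨p, rfl⟩ := AdjoinRoot.mk_surjective a
  induction p using Polynomial.induction_on with
  | add f g hf hg => rw [map_add]; exact hadd _ _ hf hg
  | C f =>
    rw [AdjoinRoot.mk_C]
    induction f using Polynomial.induction_on with
    | add f g hf hg => rw [map_add]; exact hadd _ _ hf hg
    | C c => exact hc c
    | monomial n c ih => rw [pow_succ, ← mul_assoc, map_mul]; exact hmul _ _ ih hy1
  | monomial n f ih => rw [pow_succ, ← mul_assoc, map_mul, AdjoinRoot.mk_X]; exact hmul _ _ ih hx1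

theorem swapCoord_injective : Function.Injective (swapCoord K q) := by
  rw [injective_iff_map_eq_zero]
  intro a ha
  obtain ⟨n, b, h1, h2⟩ := swapCoord_aux K q a
  have hinj := IsFractionRing.injective (CoordRing K q) (FunField K q)
  rw [ha, zero_mul] at h1
  have hb : b = 0 := hinj (h1.symm.trans (map_zero _).symm)
  rw [hb, map_zero, zero_mul] at h2
  exact hinj (h2.symm.trans (map_zero _).symm)

/-- The substitution `x ↦ x / y`, `y ↦ 1 / y` on the function field. It is an involution; since
`x / y` and `1 / y` are local coordinates at the point at infinity `(0 : 1 : 0)` of the projective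
curve, it interchanges the origin and the point at infinity. -/
def swap : FunField K q →+* FunField K q :=
  IsFractionRing.lift (swapCoord_injective K q)

theorem swap_algebraMap (r : CoordRing K q) :
    swap K q (algebraMap _ (FunField K q) r) = swapCoord K q r :=
  IsFractionRing.lift_algebraMap _ _

theorem swap_fx : swap K q (fx K q) = fx K q / fy K q :=
  (swap_algebraMap K q _).trans (swapCoord_cx K q)

theorem swap_fy : swap K q (fy K q) = (fy K q)⁻¹ :=
  (swap_algebraMap K q _).trans (swapCoord_cy K q)

theorem swap_constant (c : K) :
    swap K q (algebraMap K (FunField K q) c) = algebraMap K (FunField K q) c := by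
  rw [IsScalarTower.algebraMap_apply K (CoordRing K q) (FunField K q), swap_algebraMap,
    swapCoord_algebraMap, ← IsScalarTower.algebraMap_apply]

theorem swap_swap (f : FunField K q) : swap K q (swap K q f) = f := by
  have h : ∀ a : CoordRing K q, swap K q (swap K q (algebraMap _ (FunField K q) a)) =
      algebraMap _ (FunField K q) a := by
    intro a
    have hy := fy_ne_zero K q
    obtain ⟨n, b, h1, h2⟩ := swapCoord_aux K q a
    have h3 := congrArg (swap K q) h1
    rw [map_mul, map_pow, swap_fy, swap_algebraMap] at h3
    rw [swap_algebraMap, ← h2, ← h3, mul_assoc, ← mul_pow, inv_mul_cancel₀ hy, one_pow, mul_one]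
  obtain ⟨a, b, _, rfl⟩ := IsFractionRing.div_surjective (A := CoordRing K q) f
  rw [map_div₀, map_div₀, h, h]

/-- The point at infinity `P_∞`. -/
def pInfty : Place K (FunField K q) where
  val := (pZero K q).val.comap (swap K q)
  surjective := (pZero K q).surjective.comp fun f => ⟨swap K q f, swap_swap K q f⟩
  trivial_on_constants c hc := by
    rw [Valuation.comap_apply, swap_constant]
    exact (pZero K q).trivial_on_constants c hc

theorem fx_ne_zero : fx K q ≠ 0 := by
  intro h
  have h1 := fun_equation K q
  have hq := two_le K q
  have h2 : fy K q ^ (q - 1) + 1 = 0 := by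
    rw [h, zero_pow (by omega)] at h1
    have : fy K q * (fy K q ^ (q - 1) + 1) = 0 := by
      rw [mul_add, mul_one, mul_pow_sub_one (by omega), h1]
    exact (mul_eq_zero.1 this).resolve_left (fy_ne_zero K q)
  have h3 : cy K q ^ (q - 1) + 1 = 0 := by
    apply IsFractionRing.injective (CoordRing K q) (FunField K q)
    rw [map_add, map_pow, map_one, map_zero]
    exact h2
  have h4 := congrArg (evalOrigin K q) h3
  rw [map_add, map_pow, evalOrigin_cy, zero_pow (by omega)] at h4
  simp at h4

theorem ord_pos_iff {f : FunField K q} (P : Place K (FunField K q)) (hf : f ≠ 0) :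
    0 < P.ord f ↔ P.val f < 1 := by
  rw [Place.ord, neg_pos, WithZero.log_lt_iff_lt_exp (P.val_ne_zero hf), WithZero.exp_zero]

/-- `P_0` is a common zero of `x` and `y`. -/
theorem pZero_spec : 0 < (pZero K q).ord (fx K q) ∧ 0 < (pZero K q).ord (fy K q) := by
  rw [ord_pos_iff K q _ (fx_ne_zero K q), ord_pos_iff K q _ (fy_ne_zero K q)]
  exact ⟨originVal_lt_one K q _ (evalOrigin_cx K q), originVal_lt_one K q _ (evalOrigin_cy K q)⟩

/-- At `P_∞` the functions `x / y` and `1 / y` vanish. -/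
theorem pInfty_spec :
    0 < (pInfty K q).ord (fx K q / fy K q) ∧ 0 < (pInfty K q).ord (fy K q)⁻¹ := by
  have h : ∀ f, (pInfty K q).ord f = (pZero K q).ord (swap K q f) := fun _ => rfl
  rw [h, h, ← swap_fx, ← swap_fy, swap_swap, swap_swap]
  exact pZero_spec K q

/-- The genus `g` of the Hermitian curve. -/
def genus : ℕ := cechGenus (pInfty K q) (pZero K q)

/-- The multiplicity `m_{P_∞}(a, b)` for the divisor `a P_∞ + b P_0`. -/
def multInfty (a b : ℤ) : ℕ := multiplicityAt (pInfty K q) a (pZero K q) b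

/-- The multiplicity `m_{P_0}(a, b)` for the divisor `a P_∞ + b P_0`. -/
def multZero (a b : ℤ) : ℕ := multiplicityAt (pZero K q) b (pInfty K q) a

end Hermitian

end

/-! Everything reduces to counting monomials `y ^ n * x ^ m` with `n ∈ ℤ` and `0 ≤ m ≤ q`. They form
a `K`-basis of the functions regular away from `P_∞` and `P_0` (`exists_comb_eq`, `comb_injective`).
At `P_∞` their pole orders `n (q + 1) + m q` are pairwise different, and so are their pole orders
`-(n (q + 1) + m)` at `P_0`. No cancellation of leading terms is therefore possible at either point,
and a combination lies in `L(a P_∞ + b P_0)` iff each of its monomials does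
(`comb_mem_riemannRoch_iff`).

Spanning needs two geometric facts. The only zero of `y` is `P_0` and its only pole is `P_∞`
(`val_fy_eq_one`). The affine curve is smooth, so each of its closed points gives a place
(`exists_place`). A function regular away from the two points then becomes an element of `K[x, y]`
after multiplication by a power of `y`.

In this basis the genus counts the monomials with poles at both points, and `m_{P_∞}(a, b)` counts
the monomials of pole order at most `b` at `P_0` which some monomial regular at `P_0` completes to
pole order `a + 1` at `P_∞` (`multInfty_eq_ncard`). For fixed `m` the admissible `n` form an
interval, and summing the lengths of the `q + 1` intervals gives the three cases. The involution
`swap` exchanges the two points and carries the formulas over to `P_0`. -/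

noncomputable section

/-! ### Zeros and poles of `x` and `y` -/

namespace Hermitian

variable (K : Type*) [Field K] (q : ℕ) [Finite K] [Fact (Nat.card K = q ^ 2)]

/-- Every function is a power of `x` times a quotient of functions not vanishing at the origin. -/
theorem exists_zpow_mul_div {f : FunField K q} (hf : f ≠ 0) :
    ∃ (n : ℤ) (u v : CoordRing K q), evalOrigin K q u ≠ 0 ∧ evalOrigin K q v ≠ 0 ∧
      f = fx K q ^ n * (algebraMap _ (FunField K q) u / algebraMap _ (FunField K q) v) := by
  have hirr : Irreducible (algebraMap (CoordRing K q) (OriginLocal K q) (cx K q)) := by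
    rw [IsDiscreteValuationRing.irreducible_iff_uniformizer]
    exact maximalIdeal_eq K q
  have hunit : ∀ w : (OriginLocal K q)ˣ, ∃ u v : CoordRing K q, evalOrigin K q u ≠ 0 ∧
      evalOrigin K q v ≠ 0 ∧ algebraMap _ (FunField K q) (w : OriginLocal K q) =
        algebraMap _ (FunField K q) u / algebraMap _ (FunField K q) v := by
    intro w
    obtain ⟨⟨u, v⟩, huv⟩ := IsLocalization.surj (originIdeal K q).primeCompl (w : OriginLocal K q)
    have hv : IsUnit (algebraMap (CoordRing K q) (OriginLocal K q) v) :=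
      IsLocalization.map_units _ v
    have hu : IsUnit (algebraMap (CoordRing K q) (OriginLocal K q) u) := by
      rw [← huv]; exact w.isUnit.mul hv
    have hu' : u ∈ (originIdeal K q).primeCompl :=
      (IsLocalization.AtPrime.isUnit_to_map_iff (OriginLocal K q) (originIdeal K q) u).1 hu
    refine ⟨u, v, hu', v.2, ?_⟩
    rw [eq_div_iff, IsScalarTower.algebraMap_apply (CoordRing K q) (OriginLocal K q) (FunField K q),
      IsScalarTower.algebraMap_apply (CoordRing K q) (OriginLocal K q) (FunField K q), ← map_mul]
    · exact congrArg _ huv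
    · rw [Ne, map_eq_zero_iff _ (IsFractionRing.injective (CoordRing K q) (FunField K q))]
      intro h
      exact v.2 (h ▸ zero_mem _)
  have hloc : ∀ r : OriginLocal K q, r ≠ 0 → ∃ (n : ℕ) (u v : CoordRing K q),
      evalOrigin K q u ≠ 0 ∧ evalOrigin K q v ≠ 0 ∧ algebraMap _ (FunField K q) r =
      fx K q ^ n * (algebraMap _ (FunField K q) u / algebraMap _ (FunField K q) v) := by
    intro r hr
    obtain ⟨n, w, rfl⟩ := IsDiscreteValuationRing.eq_unit_mul_pow_irreducible hr hirr
    obtain ⟨u, v, hu, hv, h⟩ := hunit w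
    refine ⟨n, u, v, hu, hv, ?_⟩
    rw [map_mul, h, map_pow, ← IsScalarTower.algebraMap_apply, mul_comm]
    rfl
  obtain ⟨r, s, hs, rfl⟩ := IsFractionRing.div_surjective (A := OriginLocal K q) f
  have hr : r ≠ 0 := by rintro rfl; simp at hf
  obtain ⟨n, u, v, hu, hv, h⟩ := hloc r hr
  obtain ⟨n', u', v', hu', hv', h'⟩ := hloc s (nonZeroDivisors.ne_zero hs)
  refine ⟨n - n', u * v', v * u', ?_, ?_, ?_⟩
  · rw [map_mul]; exact mul_ne_zero hu hv'
  · rw [map_mul]; exact mul_ne_zero hv hu'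
  · rw [h, h', zpow_sub₀ (fx_ne_zero K q), zpow_natCast, zpow_natCast, map_mul, map_mul,
      mul_div_mul_comm, mul_div_mul_comm, div_eq_mul_inv _ (algebraMap _ (FunField K q) u' /
      algebraMap _ (FunField K q) v'), inv_div, div_mul_div_comm, div_mul_div_comm]

variable {K q}

/-- Modulo the ideal `(x, y)` the function `u` is the nonzero constant `u(P_0)`, and `P` is positive
on that ideal. Allowing any common zero `P` of `x` and `y`, not just `pZero`, is what later yields
uniqueness. -/
theorem val_algebraMap_eq_one (P : Place K (FunField K q)) (hx : P.val (fx K q) < 1)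
    (hy : P.val (fy K q) < 1) {u : CoordRing K q} (hu : evalOrigin K q u ≠ 0) :
    P.val (algebraMap _ (FunField K q) u) = 1 := by
  have hreg : ∀ r : CoordRing K q, P.val (algebraMap _ (FunField K q) r) ≤ 1 := by
    intro r
    obtain ⟨p, rfl⟩ := AdjoinRoot.mk_surjective r
    induction p using Polynomial.induction_on with
    | add f g hf hg =>
      rw [map_add, map_add]
      exact (P.val.map_add _ _).trans (max_le hf hg)
    | C f =>
      induction f using Polynomial.induction_on with
      | add f g hf hg =>
        rw [map_add, map_add, map_add]
        exact (P.val.map_add _ _).trans (max_le hf hg)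
      | C c => exact P.val_le_one c
      | monomial n c ih =>
        rw [pow_succ, ← mul_assoc, map_mul, map_mul, map_mul, map_mul]
        exact mul_le_one' (by simpa using ih) hy.le
    | monomial n f ih =>
      rw [pow_succ, ← mul_assoc, map_mul, map_mul, map_mul, AdjoinRoot.mk_X]
      exact mul_le_one' (by simpa using ih) hx.le
  have hmem := mem_span_of_evalOrigin K q (u - algebraMap K _ (evalOrigin K q u))
    (by rw [map_sub, evalOrigin_algebraMap, sub_self])
  obtain ⟨r, s, hrs⟩ := Ideal.mem_span_pair.1 hmem
  have hlt : P.val (algebraMap _ (FunField K q) (r * cx K q + s * cy K q)) < 1 := by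
    rw [map_add, map_mul, map_mul]
    refine P.val.map_add_lt ?_ ?_
    · rw [map_mul]; exact mul_lt_one_of_nonneg_of_lt_one_right (hreg r) zero_le hx
    · rw [map_mul]; exact mul_lt_one_of_nonneg_of_lt_one_right (hreg s) zero_le hy
  rw [← sub_add_cancel u (algebraMap K _ (evalOrigin K q u)), ← hrs, map_add,
    ← IsScalarTower.algebraMap_apply]
  rw [Valuation.map_add_eq_of_lt_right] <;> rw [P.trivial_on_constants _ hu]
  exact hlt

/-- The exponent `n` does not depend on `P`, so two common zeros of `x` and `y` can differ only in
the value they give to `x`. -/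
theorem exists_val_eq_zpow {f : FunField K q} (hf : f ≠ 0) :
    ∃ n : ℤ, ∀ P : Place K (FunField K q), P.val (fx K q) < 1 → P.val (fy K q) < 1 →
      P.val f = P.val (fx K q) ^ n := by
  obtain ⟨n, u, v, hu, hv, rfl⟩ := exists_zpow_mul_div K q hf
  refine ⟨n, fun P hx hy => ?_⟩
  rw [map_mul, map_zpow₀, map_div₀, val_algebraMap_eq_one P hx hy hu,
    val_algebraMap_eq_one P hx hy hv, div_one, mul_one]

/-- All values of `P` on nonzero functions are powers of the value of `x`, and a normalized
valuation is surjective; hence `x` is a uniformizer. -/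
theorem val_fx_eq (P : Place K (FunField K q)) (hx : P.val (fx K q) < 1)
    (hy : P.val (fy K q) < 1) : P.val (fx K q) = WithZero.exp (-1) := by
  obtain ⟨f, hf⟩ := P.surjective (WithZero.exp (-1))
  have hf0 : f ≠ 0 := by
    rintro rfl
    exact WithZero.exp_ne_zero (hf.symm.trans (map_zero _))
  obtain ⟨n, hn⟩ := exists_val_eq_zpow hf0
  have hv := hn P hx hy
  obtain ⟨k, hk⟩ : ∃ k : ℤ, P.val (fx K q) = WithZero.exp k :=
    ⟨_, (WithZero.exp_log (P.val_ne_zero (fx_ne_zero K q))).symm⟩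
  rw [hk, ← WithZero.exp_zero, WithZero.exp_lt_exp] at hx
  rw [hf, hk, ← WithZero.exp_zsmul, WithZero.exp_inj, smul_eq_mul] at hv
  rw [hk, WithZero.exp_inj]
  have : k ∣ 1 := ⟨-n, by linarith⟩
  have := Int.isUnit_iff.1 (isUnit_of_dvd_one this)
  omega

/-- The place at the origin is the only common zero of `x` and `y`. -/
theorem eq_pZero (P : Place K (FunField K q)) (hx : P.val (fx K q) < 1)
    (hy : P.val (fy K q) < 1) : P = pZero K q := by
  have hx0 := (ord_pos_iff K q _ (fx_ne_zero K q)).1 (pZero_spec K q).1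
  have hy0 := (ord_pos_iff K q _ (fy_ne_zero K q)).1 (pZero_spec K q).2
  ext f : 2
  by_cases hf : f = 0
  · rw [hf, map_zero, map_zero]
  · obtain ⟨n, hn⟩ := exists_val_eq_zpow hf
    rw [hn P hx hy, hn _ hx0 hy0, val_fx_eq P hx hy, val_fx_eq _ hx0 hy0]

theorem fy_mul_add_one : fy K q * (fy K q ^ (q - 1) + 1) = fx K q ^ (q + 1) := by
  have := two_le K q
  rw [← fun_equation, mul_add, mul_one, mul_pow_sub_one (by omega)]

theorem val_fx_lt_one (P : Place K (FunField K q)) (hy : P.val (fy K q) < 1) :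
    P.val (fx K q) < 1 := by
  have hq := two_le K q
  rw [← pow_lt_one_iff_of_nonneg zero_le (n := q + 1) (by omega), ← map_pow, ← fun_equation]
  refine P.val.map_add_lt ?_ hy
  rw [map_pow]
  exact (pow_lt_one_iff_of_nonneg zero_le (by omega)).2 hy

theorem val_fx_le_one (P : Place K (FunField K q)) (hy : P.val (fy K q) ≤ 1) :
    P.val (fx K q) ≤ 1 := by
  rw [← pow_le_one_iff_of_nonneg zero_le (n := q + 1) (by omega), ← map_pow, ← fun_equation]
  refine P.val.map_add_le ?_ hy
  rw [map_pow]
  exact pow_le_one' hy _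

theorem val_pZero_fy_lt_one : (pZero K q).val (fy K q) < 1 :=
  (ord_pos_iff K q _ (fy_ne_zero K q)).1 (pZero_spec K q).2

theorem val_pZero_fx : (pZero K q).val (fx K q) = WithZero.exp (-1) :=
  val_fx_eq _ (val_fx_lt_one _ val_pZero_fy_lt_one) val_pZero_fy_lt_one

/-- In `y (y ^ (q - 1) + 1) = x ^ (q + 1)` the second factor on the left is a unit at the origin. -/
theorem val_pZero_fy : (pZero K q).val (fy K q) = WithZero.exp (-(q + 1) : ℤ) := by
  have hq := two_le K q
  have h := congrArg (pZero K q).val (fy_mul_add_one (K := K) (q := q))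
  rw [map_mul, Valuation.map_add_eq_of_lt_right, map_one, mul_one, map_pow, val_pZero_fx,
    ← WithZero.exp_nsmul] at h
  · rw [h]; congr 1; simp
  · rw [map_pow, map_one]
    exact (pow_lt_one_iff_of_nonneg zero_le (by omega)).2 val_pZero_fy_lt_one

theorem val_pInfty (f : FunField K q) : (pInfty K q).val f = (pZero K q).val (swap K q f) := rfl

theorem val_pInfty_fy : (pInfty K q).val (fy K q) = WithZero.exp (q + 1 : ℤ) := by
  rw [val_pInfty, swap_fy, map_inv₀, val_pZero_fy, ← WithZero.exp_neg, neg_neg]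

theorem val_pInfty_fx : (pInfty K q).val (fx K q) = WithZero.exp (q : ℤ) := by
  rw [val_pInfty, swap_fx, map_div₀, val_pZero_fy, val_pZero_fx, ← WithZero.exp_sub]
  congr 1; ring

/-- The image of a place under the involution `swap`. -/
def swapPlace (P : Place K (FunField K q)) : Place K (FunField K q) where
  val := P.val.comap (swap K q)
  surjective := P.surjective.comp fun f => ⟨swap K q f, swap_swap K q f⟩
  trivial_on_constants c hc := by
    rw [Valuation.comap_apply, swap_constant]
    exact P.trivial_on_constants c hc

theorem val_swapPlace (P : Place K (FunField K q)) (f : FunField K q) :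
    (swapPlace P).val f = P.val (swap K q f) := rfl

theorem swapPlace_swapPlace (P : Place K (FunField K q)) : swapPlace (swapPlace P) = P := by
  ext f : 2
  rw [val_swapPlace, val_swapPlace, swap_swap]

theorem swapPlace_pZero : swapPlace (pZero K q) = pInfty K q := rfl

theorem swapPlace_pInfty : swapPlace (pInfty K q) = pZero K q := by
  rw [← swapPlace_pZero, swapPlace_swapPlace]

theorem pInfty_ne_pZero : pInfty K q ≠ pZero K q := by
  intro h
  have h1 := val_pInfty_fy (K := K) (q := q)
  rw [h, val_pZero_fy, WithZero.exp_inj] at h1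
  omega

/-- A zero of `y` is also a zero of `x`, hence is `P_0`; `swap` inverts `y`, so a pole of `y` is
`P_∞`. -/
theorem val_fy_eq_one {P : Place K (FunField K q)} (h0 : P ≠ pZero K q) (hI : P ≠ pInfty K q) :
    P.val (fy K q) = 1 := by
  refine le_antisymm ?_ ?_
  · by_contra! h
    apply hI
    have hy : (swapPlace P).val (fy K q) < 1 := by
      rw [val_swapPlace, swap_fy, map_inv₀]
      exact inv_lt_one_of_one_lt₀ h
    rw [← swapPlace_swapPlace P, eq_pZero _ (val_fx_lt_one _ hy) hy, swapPlace_pZero]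
  · by_contra! h
    exact h0 (eq_pZero _ (val_fx_lt_one _ h) h)

end Hermitian

/-! ### Smoothness of the affine curve and the places of its closed points -/

namespace Hermitian

variable (K : Type*) [Field K] (q : ℕ)

theorem adjoin_eq_top : Algebra.adjoin K {cx K q, cy K q} = ⊤ := by
  rw [eq_top_iff]
  rintro r -
  have hx : cx K q ∈ Algebra.adjoin K {cx K q, cy K q} := Algebra.subset_adjoin (by simp)
  have hy : cy K q ∈ Algebra.adjoin K {cx K q, cy K q} := Algebra.subset_adjoin (by simp)
  obtain ⟨p, rfl⟩ := AdjoinRoot.mk_surjective r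
  induction p using Polynomial.induction_on with
  | add f g hf hg => rw [map_add]; exact add_mem hf hg
  | C f =>
    induction f using Polynomial.induction_on with
    | add f g hf hg => rw [map_add, map_add]; exact add_mem hf hg
    | C c => exact Subalgebra.algebraMap_mem _ c
    | monomial n c ih => rw [pow_succ, ← mul_assoc, map_mul, map_mul]; exact mul_mem ih hy
  | monomial n f ih => rw [pow_succ, ← mul_assoc, map_mul]; exact mul_mem ih hx

instance : Algebra.FiniteType K (CoordRing K q) :=
  ⟨⟨{cx K q, cy K q}, by simpa using adjoin_eq_top K q⟩⟩

variable [Finite K] [Fact (Nat.card K = q ^ 2)]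

theorem exists_ringChar_pow : ∃ p n : ℕ, p.Prime ∧ CharP K p ∧ q = p ^ n := by
  have := Fintype.ofFinite K
  obtain ⟨p, hp, n, hprime, hn⟩ := FiniteField.card' K
  have h : q ^ 2 = p ^ (n : ℕ) := by
    rw [← hn, Fintype.card_eq_nat_card]
    exact (Fact.out : Nat.card K = q ^ 2).symm
  obtain ⟨k, -, hk⟩ := (Nat.dvd_prime_pow hprime).1 (h ▸ dvd_pow_self q two_ne_zero)
  exact ⟨p, k, hprime, hp, hk⟩

/-- Applying the additive map `r ↦ r ^ q` to `y ^ q = x ^ (q + 1) - y` and substituting the same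
equation again restores `y` up to a polynomial in `x`. This special feature of the Hermitian
equation replaces a Jacobian criterion. -/
theorem cy_pow_card : ∃ c : K[X], cy K q ^ q ^ 2 = cy K q + aeval (cx K q) c := by
  obtain ⟨p, n, hp, hchar, hq⟩ := exists_ringChar_pow K q
  have : CharP (CoordRing K q) p := charP_of_injective_algebraMap' K p
  have : ExpChar (CoordRing K q) p := .prime hp
  have h : cy K q ^ q = cx K q ^ (q + 1) - cy K q := by rw [← coord_equation]; ring
  have hsub : ∀ r s : CoordRing K q, (r - s) ^ q = r ^ q - s ^ q := fun r s => by
    have := sub_pow_expChar_pow (n := n) (p := p) r s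
    rwa [← hq] at this
  have h2 : cy K q ^ q ^ 2 = (cx K q ^ (q + 1)) ^ q - cy K q ^ q := by
    rw [pow_two, pow_mul]
    conv_lhs => rw [h]
    exact hsub _ _
  refine ⟨X ^ ((q + 1) * q) - X ^ (q + 1), ?_⟩
  rw [h2, h, map_sub, map_pow, map_pow, aeval_X, pow_mul]
  ring

/-- The `q ^ 2`-power map of the coordinate ring and its iterates. -/
theorem exists_algHom_pow (N : ℕ) :
    ∃ φ : CoordRing K q →ₐ[K] CoordRing K q, ∀ r, φ r = r ^ (q ^ 2) ^ N := by
  have := Fintype.ofFinite K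
  refine ⟨(FiniteField.frobeniusAlgHom K (CoordRing K q)) ^ N, fun r => ?_⟩
  have hc : Fintype.card K = q ^ 2 := by
    rw [Fintype.card_eq_nat_card]
    exact Fact.out
  rw [AlgHom.coe_pow, FiniteField.coe_frobeniusAlgHom, pow_iterate, hc]

theorem cy_pow_card_pow (N : ℕ) :
    ∃ c : K[X], cy K q ^ (q ^ 2) ^ N = cy K q + aeval (cx K q) c := by
  induction N with
  | zero => exact ⟨0, by simp⟩
  | succ N ih =>
    obtain ⟨c, hc⟩ := ih
    obtain ⟨d, hd⟩ := cy_pow_card K q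
    obtain ⟨φ, hφ⟩ := exists_algHom_pow K q 1
    simp only [pow_one] at hφ
    refine ⟨d + c ^ q ^ 2, ?_⟩
    rw [pow_succ (q ^ 2), pow_mul, hc, ← hφ, map_add, hφ, hφ, hd, map_add, map_pow]
    ring

/-- Every maximal ideal `m` contains an element `p` (a polynomial in `x`) with `r ^ Q = r` modulo `p`
for all `r`. For `r` in `m` the factor `r ^ (Q - 1) - 1` of `r ^ Q - r` is a unit locally at `m`, so
`p` generates `m` locally. -/
theorem exists_dvd_pow_sub (m : Ideal (CoordRing K q)) [m.IsMaximal] :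
    ∃ p ∈ m, ∃ Q : ℕ, 2 ≤ Q ∧ ∀ r, p ∣ r ^ Q - r := by
  let : Field (CoordRing K q ⧸ m) := Ideal.Quotient.field m
  have hfin : Module.Finite K (CoordRing K q ⧸ m) := finite_of_finite_type_of_isJacobsonRing _ _
  have hfin' : Finite (CoordRing K q ⧸ m) := Module.finite_of_finite K
  let := Fintype.ofFinite (CoordRing K q ⧸ m)
  set N := Module.finrank K (CoordRing K q ⧸ m)
  have hcard : Fintype.card (CoordRing K q ⧸ m) = (q ^ 2) ^ N := by
    rw [Fintype.card_eq_nat_card, Module.natCard_eq_pow_finrank (K := K),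
      (Fact.out : Nat.card K = q ^ 2)]
  set Q := (q ^ 2) ^ N with hQ
  have hpow : ∀ r : CoordRing K q, r ^ Q - r ∈ m := fun r => by
    rw [← Ideal.Quotient.eq, map_pow, ← hcard, FiniteField.pow_card]
  -- The required element generates the contraction of `m` to `K[x]`; it divides every polynomial in
  -- `x` that lies in `m`.
  set I := m.comap (aeval (cx K q) : K[X] →ₐ[K] CoordRing K q)
  set p := Submodule.IsPrincipal.generator I
  have hdvd : ∀ c : K[X], aeval (cx K q) c ∈ m → aeval (cx K q) p ∣ aeval (cx K q) c :=
    fun c hc => map_dvd _ ((Submodule.IsPrincipal.mem_iff_generator_dvd I).1 hc)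
  refine ⟨aeval (cx K q) p, Submodule.IsPrincipal.generator_mem I, Q,
    hcard ▸ Fintype.one_lt_card, ?_⟩
  obtain ⟨φ, hφ⟩ := exists_algHom_pow K q N
  -- Since `Q` is a power of the order of `K`, the map `r ↦ r ^ Q` is a `K`-algebra map, so `r ^ Q ≡
  -- r` modulo `p` need only be checked at `x` and `y`. In both cases the difference is a polynomial
  -- in `x` lying in `m`.
  have key : (Ideal.Quotient.mkₐ K (Ideal.span {aeval (cx K q) p})).comp φ =
      Ideal.Quotient.mkₐ K (Ideal.span {aeval (cx K q) p}) := by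
    apply AlgHom.ext_of_adjoin_eq_top (adjoin_eq_top K q)
    rintro r (rfl | rfl)
    · change Ideal.Quotient.mk _ _ = Ideal.Quotient.mk _ _
      rw [Ideal.Quotient.eq, Ideal.mem_span_singleton]
      change _ ∣ φ _ - _
      rw [hφ]
      have := hdvd (X ^ Q - X) (by simpa using hpow (cx K q))
      simpa using this
    · change Ideal.Quotient.mk _ _ = Ideal.Quotient.mk _ _
      rw [Ideal.Quotient.eq, Ideal.mem_span_singleton]
      change _ ∣ φ _ - _
      rw [hφ]
      obtain ⟨c, hc⟩ := cy_pow_card_pow K q N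
      have h := hpow (cy K q)
      rw [hQ, hc, add_sub_cancel_left] at h
      rw [hc, add_sub_cancel_left]
      exact hdvd c h
  intro r
  have h := DFunLike.congr_fun key r
  change Ideal.Quotient.mk _ _ = Ideal.Quotient.mk _ _ at h
  rw [Ideal.Quotient.eq, Ideal.mem_span_singleton] at h
  change _ ∣ φ r - r at h
  rwa [hφ] at h

theorem maximalIdeal_isPrincipal (m : Ideal (CoordRing K q)) [m.IsMaximal] :
    (IsLocalRing.maximalIdeal (Localization.AtPrime m)).IsPrincipal := by
  obtain ⟨p, hp, Q, hQ, hdvd⟩ := exists_dvd_pow_sub K q m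
  refine ⟨algebraMap _ _ p, ?_⟩
  rw [← Localization.AtPrime.map_eq_maximalIdeal]
  apply le_antisymm
  · rw [Ideal.map_le_iff_le_comap]
    intro r hr
    rw [Ideal.mem_comap]
    refine Ideal.mem_span_singleton.2 ?_
    have hu : IsUnit (algebraMap (CoordRing K q) (Localization.AtPrime m) (r ^ (Q - 1) - 1)) := by
      rw [IsLocalization.AtPrime.isUnit_to_map_iff _ m]
      intro h
      refine (Ideal.ne_top_iff_one m).1 (Ideal.IsPrime.ne_top inferInstance) ?_
      have := sub_mem (m.pow_mem_of_mem hr (Q - 1) (by omega)) h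
      rwa [sub_sub_cancel] at this
    rw [← hu.dvd_mul_right, ← map_mul, mul_sub, mul_one, mul_pow_sub_one (by omega)]
    exact map_dvd _ (hdvd r)
  · refine (Ideal.span_singleton_le_iff_mem _).2 (Ideal.mem_map_of_mem _ hp)

/-- The place of a closed point of the affine curve. -/
theorem exists_place (m : Ideal (CoordRing K q)) [m.IsMaximal] (hm : m ≠ ⊥) :
    ∃ P : Place K (FunField K q), (∀ f, P.val f ≤ 1 ↔ ∃ r s : CoordRing K q, s ∉ m ∧
      f * algebraMap _ (FunField K q) s = algebraMap _ (FunField K q) r) := by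
  have : IsDomain (Localization.AtPrime m) :=
    IsLocalization.isDomain_of_le_nonZeroDivisors _ m.primeCompl_le_nonZeroDivisors
  have : IsNoetherianRing (Localization.AtPrime m) :=
    IsLocalization.isNoetherianRing m.primeCompl _ inferInstance
  have hfield : ¬ IsField (Localization.AtPrime m) := by
    rw [IsLocalRing.isField_iff_maximalIdeal_eq, ← Localization.AtPrime.map_eq_maximalIdeal]
    intro h
    apply hm
    rw [eq_bot_iff]
    intro r hr
    have h1 := Ideal.mem_map_of_mem (algebraMap _ (Localization.AtPrime m)) hr
    rw [h, Ideal.mem_bot] at h1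
    exact IsLocalization.injective _ m.primeCompl_le_nonZeroDivisors (h1.trans (map_zero _).symm)
  have : IsDiscreteValuationRing (Localization.AtPrime m) :=
    ((IsDiscreteValuationRing.TFAE _ hfield).out 0 4 :
      IsDiscreteValuationRing (Localization.AtPrime m) ↔
        (IsLocalRing.maximalIdeal (Localization.AtPrime m)).IsPrincipal).2
      (maximalIdeal_isPrincipal K q m)
  set v := (IsDiscreteValuationRing.maximalIdeal (Localization.AtPrime m)).valuation
    (FunField K q) with hv
  have hle : ∀ r : CoordRing K q, v (algebraMap _ (FunField K q) r) ≤ 1 := fun r => by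
    rw [IsScalarTower.algebraMap_apply (CoordRing K q) (Localization.AtPrime m) (FunField K q)]
    exact IsDedekindDomain.HeightOneSpectrum.valuation_le_one _ _
  have htriv : ∀ c : K, c ≠ 0 → v (algebraMap K (FunField K q) c) = 1 := by
    intro c hc
    have hle' : ∀ c : K, v (algebraMap K (FunField K q) c) ≤ 1 := fun c => by
      rw [IsScalarTower.algebraMap_apply K (CoordRing K q) (FunField K q)]
      exact hle _
    refine le_antisymm (hle' c) ?_
    have h0 : v (algebraMap K (FunField K q) c) ≠ 0 := by simpa using hc
    rw [← inv_le_one₀ (zero_lt_iff.2 h0), ← map_inv₀, ← map_inv₀]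
    exact hle' c⁻¹
  refine ⟨⟨v, IsDedekindDomain.HeightOneSpectrum.valuation_surjective _ _, htriv⟩, fun f => ?_⟩
  constructor
  · intro h
    obtain ⟨z, rfl⟩ := IsDiscreteValuationRing.exists_lift_of_le_one h
    obtain ⟨⟨r, s⟩, hrs⟩ := IsLocalization.surj m.primeCompl z
    refine ⟨r, s, s.2, ?_⟩
    rw [IsScalarTower.algebraMap_apply (CoordRing K q) (Localization.AtPrime m) (FunField K q),
      IsScalarTower.algebraMap_apply (CoordRing K q) (Localization.AtPrime m) (FunField K q),
      ← map_mul]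
    exact congrArg _ hrs
  · rintro ⟨r, s, hs, hrs⟩
    obtain ⟨z, hz⟩ := IsLocalization.map_units (Localization.AtPrime m)
      (⟨s, hs⟩ : m.primeCompl)
    have h1 : v (algebraMap _ (FunField K q) s) = 1 := by
      refine le_antisymm (hle s) ?_
      have hz' : v (algebraMap _ (FunField K q) ((z⁻¹ : (Localization.AtPrime m)ˣ) :
          Localization.AtPrime m)) * v (algebraMap _ (FunField K q) s) = 1 := by
        rw [← map_mul, IsScalarTower.algebraMap_apply (CoordRing K q) (Localization.AtPrime m)
          (FunField K q), ← map_mul]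
        erw [← hz]
        rw [Units.inv_mul, map_one, map_one]
      rw [← hz']
      exact mul_le_of_le_one_left' (IsDedekindDomain.HeightOneSpectrum.valuation_le_one _ _)
    have h2 := congrArg v hrs
    rw [map_mul, h1, mul_one] at h2
    exact h2.trans_le (hle r)

end Hermitian

/-! ### The monomial basis of the functions regular outside the two points -/

namespace Hermitian

variable (K : Type*) [Field K] (q : ℕ) [Finite K] [Fact (Nat.card K = q ^ 2)]

/-- The function `y ^ n * x ^ m` for `i = (n, m)`. -/
def mon (i : ℤ × Fin (q + 1)) : FunField K q := fy K q ^ i.1 * fx K q ^ (i.2 : ℕ)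

/-- Division by the defining polynomial, monic of degree `q + 1` in `x`, leaves only the powers `x ^
m` with `m ≤ q`. -/
theorem algebraMap_mem_span_mon (r : CoordRing K q) :
    algebraMap _ (FunField K q) r ∈ Submodule.span K (mon K q '' {i | 0 ≤ i.1}) := by
  have hC : ∀ (m : Fin (q + 1)) (f : K[X]), algebraMap _ (FunField K q)
      (AdjoinRoot.of (poly K q) f * cx K q ^ (m : ℕ)) ∈
      Submodule.span K (mon K q '' {i | 0 ≤ i.1}) := by
    intro m f
    induction f using Polynomial.induction_on' with
    | add f g hf hg => rw [map_add, add_mul, map_add]; exact add_mem hf hg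
    | monomial n c =>
      have h : algebraMap _ (FunField K q) (AdjoinRoot.of (poly K q) (monomial n c) *
          cx K q ^ (m : ℕ)) = c • mon K q (n, m) := by
        have e : AdjoinRoot.of (poly K q) (monomial n c) =
            algebraMap K (CoordRing K q) c * cy K q ^ n := by
          rw [← C_mul_X_pow_eq_monomial, map_mul, map_pow]
          rfl
        rw [Algebra.smul_def, IsScalarTower.algebraMap_apply K (CoordRing K q) (FunField K q), mon,
          zpow_natCast, fx, fy, e, map_mul, map_mul, map_pow, map_pow, mul_assoc]
      rw [h]
      exact Submodule.smul_mem _ _ (Submodule.subset_span ⟨_, by simp, rfl⟩)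
  obtain ⟨p, rfl⟩ := AdjoinRoot.mk_surjective r
  have hp : AdjoinRoot.mk (poly K q) p = AdjoinRoot.mk (poly K q) (p %ₘ poly K q) := by
    rw [AdjoinRoot.mk_eq_mk]
    exact ⟨p /ₘ poly K q, by rw [sub_eq_iff_eq_add, add_comm, modByMonic_add_div]⟩
  have hdeg : (p %ₘ poly K q).natDegree < q + 1 := by
    have h1 : (poly K q).natDegree = q + 1 := by
      unfold poly
      exact natDegree_X_pow_sub_C
    rw [← h1]
    refine natDegree_modByMonic_lt _ (poly_monic K q) fun h => ?_
    rw [h, natDegree_one] at h1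
    omega
  rw [hp, as_sum_range_C_mul_X_pow' _ hdeg, map_sum, map_sum]
  refine sum_mem fun m hm => ?_
  rw [map_mul, map_pow, AdjoinRoot.mk_X]
  exact hC ⟨m, Finset.mem_range.1 hm⟩ _

variable {K q}

/-- A Nullstellensatz argument: the ideal `I` of denominators of `f` can vanish only at points where
`y` does, so it contains a power of `y`. -/
theorem exists_fy_pow_mul_eq {f : FunField K q}
    (hf : f ∈ regularOutside {pInfty K q, pZero K q}) :
    ∃ (n : ℕ) (r : CoordRing K q), fy K q ^ n * f = algebraMap _ (FunField K q) r := by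
  have hinj := IsFractionRing.injective (CoordRing K q) (FunField K q)
  let I : Ideal (CoordRing K q) :=
    { carrier := {s | ∃ r : CoordRing K q, f * algebraMap _ (FunField K q) s = algebraMap _ (FunField K q) r}
      zero_mem' := ⟨0, by simp⟩
      add_mem' := by
        rintro s s' ⟨r, h⟩ ⟨r', h'⟩
        exact ⟨r + r', by rw [map_add, mul_add, h, h', map_add]⟩
      smul_mem' := by
        rintro c s ⟨r, h⟩
        exact ⟨c * r, by rw [smul_eq_mul, map_mul, mul_left_comm, h, map_mul]⟩ }
  have hrad : cy K q ∈ I.radical := by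
    have : IsJacobsonRing (CoordRing K q) := isJacobsonRing_of_finiteType (A := K)
    rw [Ideal.radical_eq_jacobson, Ideal.jacobson, Ideal.mem_sInf]
    rintro m ⟨hIm, hmax⟩
    by_contra hy
    -- `I` contains a nonzero denominator of `f`, so an ideal above it is not zero.
    have hm : m ≠ ⊥ := by
      rintro rfl
      obtain ⟨r, s, hs, rfl⟩ := IsFractionRing.div_surjective (A := CoordRing K q) f
      have hs0 := nonZeroDivisors.ne_zero hs
      refine hs0 ((Ideal.mem_bot).1 (hIm ⟨r, div_mul_cancel₀ _ ?_⟩))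
      rwa [Ne, map_eq_zero_iff _ hinj]
    obtain ⟨P, hP⟩ := exists_place K q m hm
    -- As `y ∉ m`, the function `y` is a unit at `P`. This excludes `P_∞` and `P_0`, so `f` is
    -- regular at `P` and has a denominator outside `m`, against `I ≤ m`.
    have hy1 : P.val (fy K q) ≤ 1 :=
      (hP _).2 ⟨cy K q, 1, (Ideal.ne_top_iff_one m).1 hmax.ne_top, by simp [fy]⟩
    have hy2 : P.val (fy K q)⁻¹ ≤ 1 :=
      (hP _).2 ⟨1, cy K q, hy, by rw [map_one]; exact inv_mul_cancel₀ (fy_ne_zero K q)⟩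
    have hPI : P ≠ pInfty K q := by
      rintro rfl
      rw [val_pInfty_fy, ← WithZero.exp_zero, WithZero.exp_le_exp] at hy1
      omega
    have hP0 : P ≠ pZero K q := by
      rintro rfl
      rw [map_inv₀, val_pZero_fy, ← WithZero.exp_neg, ← WithZero.exp_zero,
        WithZero.exp_le_exp] at hy2
      omega
    obtain ⟨r, s, hs, hrs⟩ := (hP f).1 (hf P (by simp [hPI, hP0]))
    exact hs (hIm ⟨r, hrs⟩)
  obtain ⟨n, r, hr⟩ := hrad
  refine ⟨n, r, ?_⟩
  rw [← hr, map_pow, mul_comm]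
  rfl

variable (K q) in
/-- The linear combination of the functions `y ^ n * x ^ m` with given coefficients. -/
def comb : (ℤ × Fin (q + 1) →₀ K) →ₗ[K] FunField K q := Finsupp.linearCombination K (mon K q)

theorem comb_apply (c : ℤ × Fin (q + 1) →₀ K) :
    comb K q c = ∑ i ∈ c.support, algebraMap K (FunField K q) (c i) * mon K q i := by
  rw [comb, Finsupp.linearCombination_apply, Finsupp.sum]
  exact Finset.sum_congr rfl fun i _ => Algebra.smul_def _ _

/-- The pole order of `y ^ n * x ^ m` at `P_∞`. -/
def poleInfty (q : ℕ) (i : ℤ × Fin (q + 1)) : ℤ := i.1 * (q + 1) + (i.2 : ℕ) * q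

/-- The pole order of `y ^ n * x ^ m` at `P_0`. -/
def poleZero (q : ℕ) (i : ℤ × Fin (q + 1)) : ℤ := -(i.1 * (q + 1) + (i.2 : ℕ))

theorem poleZero_injective (q : ℕ) : Function.Injective (poleZero q) := by
  rintro ⟨n, m, hm⟩ ⟨n', m', hm'⟩ h
  simp only [poleZero] at h
  have h1 : (n - n') * (q + 1) = m' - m := by linarith
  have h2 : n - n' = 0 := by
    by_contra hne
    rcases lt_or_gt_of_ne hne with hlt | hlt <;> nlinarith
  rw [h2, zero_mul] at h1
  ext
  · simp only; omega
  · simp only; omega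

/-- The pole order is `(n + m) (q + 1) - m`, so its residue modulo `q + 1` determines `m ≤ q`, and
then `n`. -/
theorem poleInfty_injective (q : ℕ) : Function.Injective (poleInfty q) := by
  rintro ⟨n, m, hm⟩ ⟨n', m', hm'⟩ h
  simp only [poleInfty] at h
  have h1 : (n + m - n' - m') * (q + 1) = (m : ℤ) - m' := by linarith
  have h2 : n + m - n' - m' = 0 := by
    by_contra hne
    rcases lt_or_gt_of_ne hne with hlt | hlt <;> nlinarith
  rw [h2, zero_mul] at h1
  ext
  · simp only; omega
  · simp only; omega

theorem val_pInfty_mon (i : ℤ × Fin (q + 1)) :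
    (pInfty K q).val (mon K q i) = WithZero.exp (poleInfty q i) := by
  rw [mon, map_mul, map_zpow₀, map_pow, val_pInfty_fy, val_pInfty_fx, ← WithZero.exp_zsmul,
    ← WithZero.exp_nsmul, ← WithZero.exp_add]
  simp [poleInfty]

theorem val_pZero_mon (i : ℤ × Fin (q + 1)) :
    (pZero K q).val (mon K q i) = WithZero.exp (poleZero q i) := by
  rw [mon, map_mul, map_zpow₀, map_pow, val_pZero_fy, val_pZero_fx, ← WithZero.exp_zsmul,
    ← WithZero.exp_nsmul, ← WithZero.exp_add]
  congr 1
  simp [poleZero]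
  ring

theorem val_mon_le_one (i : ℤ × Fin (q + 1)) {P : Place K (FunField K q)}
    (hI : P ≠ pInfty K q) (h0 : P ≠ pZero K q) : P.val (mon K q i) ≤ 1 := by
  have hy := val_fy_eq_one h0 hI
  rw [mon, map_mul, map_zpow₀, map_pow, hy, one_zpow, one_mul]
  exact pow_le_one' (val_fx_le_one P hy.le) _

theorem comb_mem_regularOutside (c : ℤ × Fin (q + 1) →₀ K) :
    comb K q c ∈ regularOutside {pInfty K q, pZero K q} := by
  rw [comb_apply]
  refine sum_mem fun i _ => ?_
  rw [← Algebra.smul_def]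
  refine Submodule.smul_mem _ _ fun P hP => ?_
  simp only [Set.mem_insert_iff, Set.mem_singleton_iff, not_or] at hP
  exact val_mon_le_one i hP.1 hP.2

/-- Dividing by the power of `y` that clears denominators only shifts the exponent of `y`; this is
why that exponent ranges over `ℤ`. -/
theorem exists_comb_eq {f : FunField K q} (hf : f ∈ regularOutside {pInfty K q, pZero K q}) :
    ∃ c, comb K q c = f := by
  obtain ⟨n, r, hr⟩ := exists_fy_pow_mul_eq hf
  have h1 : algebraMap _ (FunField K q) r ∈ Submodule.span K (Set.range (mon K q)) :=
    Submodule.span_mono (Set.image_subset_range _ _) (algebraMap_mem_span_mon K q r)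
  have h2 : f = LinearMap.mulLeft K ((fy K q ^ n)⁻¹) (algebraMap _ (FunField K q) r) := by
    rw [LinearMap.mulLeft_apply, ← hr, inv_mul_cancel_left₀ (pow_ne_zero _ (fy_ne_zero K q))]
  have h3 := Submodule.mem_map_of_mem (f := LinearMap.mulLeft K ((fy K q ^ n)⁻¹)) h1
  rw [← h2, Submodule.map_span] at h3
  have h4 : f ∈ Submodule.span K (Set.range (mon K q)) := by
    refine Submodule.span_mono ?_ h3
    rintro _ ⟨_, ⟨i, rfl⟩, rfl⟩
    refine ⟨(i.1 - n, i.2), ?_⟩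
    rw [LinearMap.mulLeft_apply, mon, mon, zpow_sub₀ (fy_ne_zero K q), zpow_natCast]
    ring
  rw [← Set.image_univ, Finsupp.mem_span_image_iff_linearCombination K] at h4
  obtain ⟨c, -, hc⟩ := h4
  exact ⟨c, hc⟩

/-- The valuation of a linear combination of elements with pairwise different valuations. -/
theorem _root_.Place.val_sum_eq {k F ι : Type*} [Field k] [Field F] [Algebra k F] (P : Place k F)
    {b : ι → F} {w : ι → ℤ} (hw : Function.Injective w) (hb : ∀ i, P.val (b i) = WithZero.exp (w i))
    {c : ι →₀ k} (hc : c ≠ 0) :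
    ∃ i ∈ c.support, P.val (∑ i ∈ c.support, algebraMap k F (c i) * b i) = WithZero.exp (w i) ∧
      ∀ j ∈ c.support, w j ≤ w i := by
  classical
  obtain ⟨i, hi, hmax⟩ := c.support.exists_max_image w (Finsupp.support_nonempty_iff.2 hc)
  have hval : ∀ j ∈ c.support, P.val (algebraMap k F (c j) * b j) = WithZero.exp (w j) := by
    intro j hj
    rw [map_mul, P.trivial_on_constants _ (Finsupp.mem_support_iff.1 hj), one_mul, hb]
  refine ⟨i, hi, ?_, hmax⟩
  rw [Valuation.map_sum_eq_of_lt _ hi, hval i hi]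
  intro j hj
  rw [Finset.mem_sdiff, Finset.mem_singleton] at hj
  rw [hval i hi, hval j hj.1, WithZero.exp_lt_exp]
  exact lt_of_le_of_ne (hmax j hj.1) (hw.ne hj.2)

theorem val_pInfty_comb {c : ℤ × Fin (q + 1) →₀ K} (hc : c ≠ 0) :
    ∃ i ∈ c.support, (pInfty K q).val (comb K q c) = WithZero.exp (poleInfty q i) ∧
      ∀ j ∈ c.support, poleInfty q j ≤ poleInfty q i := by
  rw [comb_apply]
  exact (pInfty K q).val_sum_eq (poleInfty_injective q) val_pInfty_mon hc

theorem val_pZero_comb {c : ℤ × Fin (q + 1) →₀ K} (hc : c ≠ 0) :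
    ∃ i ∈ c.support, (pZero K q).val (comb K q c) = WithZero.exp (poleZero q i) ∧
      ∀ j ∈ c.support, poleZero q j ≤ poleZero q i := by
  rw [comb_apply]
  exact (pZero K q).val_sum_eq (poleZero_injective q) val_pZero_mon hc

theorem comb_injective : Function.Injective (comb K q) := by
  rw [injective_iff_map_eq_zero]
  intro c h
  by_contra hc
  obtain ⟨i, -, hi, -⟩ := val_pZero_comb hc
  rw [h, map_zero] at hi
  exact WithZero.exp_ne_zero hi.symm

theorem val_pInfty_comb_le_iff (c : ℤ × Fin (q + 1) →₀ K) (a : ℤ) :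
    (pInfty K q).val (comb K q c) ≤ WithZero.exp a ↔ ∀ i ∈ c.support, poleInfty q i ≤ a := by
  by_cases hc : c = 0
  · simp [hc]
  · obtain ⟨i, hi, h, hmax⟩ := val_pInfty_comb hc
    rw [h, WithZero.exp_le_exp]
    exact ⟨fun h j hj => (hmax j hj).trans h, fun h => h i hi⟩

theorem val_pZero_comb_le_iff (c : ℤ × Fin (q + 1) →₀ K) (a : ℤ) :
    (pZero K q).val (comb K q c) ≤ WithZero.exp a ↔ ∀ i ∈ c.support, poleZero q i ≤ a := by
  by_cases hc : c = 0
  · simp [hc]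
  · obtain ⟨i, hi, h, hmax⟩ := val_pZero_comb hc
    rw [h, WithZero.exp_le_exp]
    exact ⟨fun h j hj => (hmax j hj).trans h, fun h => h i hi⟩

end Hermitian

/-! ### The genus -/

namespace Hermitian

theorem ncard_setOf_fst_mem_Icc {k : ℕ} (lo hi : ℕ → ℤ) :
    ({i | lo i.2 ≤ i.1 ∧ i.1 ≤ hi i.2} : Set (ℤ × Fin k)).ncard =
      ∑ m ∈ Finset.range k, (hi m + 1 - lo m).toNat := by
  classical
  let e : (Σ _ : Fin k, ℤ) ↪ ℤ × Fin k :=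
    ⟨fun s => (s.2, s.1), by rintro ⟨m, n⟩ ⟨m', n'⟩ h; simp_all⟩
  have h : ({i | lo i.2 ≤ i.1 ∧ i.1 ≤ hi i.2} : Set (ℤ × Fin k)) =
      ((Finset.univ.sigma fun m : Fin k => Finset.Icc (lo m) (hi m)).map e : Finset _) := by
    ext ⟨n, m⟩
    simp only [Set.mem_ofPred_eq, Finset.coe_map, Set.mem_image, SetLike.mem_coe,
      Finset.mem_sigma, Finset.mem_univ, true_and, Finset.mem_Icc]
    constructor
    · intro h
      exact ⟨⟨m, n⟩, h, rfl⟩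
    · rintro ⟨⟨m', n'⟩, h, h'⟩
      obtain ⟨rfl, rfl⟩ := Prod.ext_iff.1 h'
      exact h
  rw [h, Set.ncard_coe_finset, Finset.card_map, Finset.card_sigma, Finset.sum_range]
  simp only [Int.card_Icc]

theorem poleZero_nonpos_iff {q : ℕ} (i : ℤ × Fin (q + 1)) : poleZero q i ≤ 0 ↔ 0 ≤ i.1 := by
  obtain ⟨n, m, hm⟩ := i
  simp only [poleZero]
  constructor
  · intro h
    by_contra! hn
    nlinarith
  · intro h
    have := mul_nonneg h (by positivity : (0 : ℤ) ≤ q + 1)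
    linarith [Int.natCast_nonneg m]

theorem poleInfty_nonpos_iff {q : ℕ} (i : ℤ × Fin (q + 1)) :
    poleInfty q i ≤ 0 ↔ i.1 + (i.2 : ℕ) ≤ 0 := by
  obtain ⟨n, m, hm⟩ := i
  simp only [poleInfty]
  constructor
  · intro h
    by_contra! hn
    nlinarith
  · intro h
    nlinarith

variable {K : Type*} [Field K] {q : ℕ} [Finite K] [Fact (Nat.card K = q ^ 2)]

theorem regularOutside_pInfty : regularOutside {pInfty K q} =
    (Finsupp.supported K K {i | poleZero q i ≤ 0}).map (comb K q) := by
  ext f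
  rw [Submodule.mem_map]
  constructor
  · intro hf
    obtain ⟨c, rfl⟩ := exists_comb_eq (f := f) fun P hP => hf P fun h => hP (by simp_all)
    refine ⟨c, ?_, rfl⟩
    exact (val_pZero_comb_le_iff c 0).1 (hf _ pInfty_ne_pZero.symm)
  · rintro ⟨c, hc, rfl⟩ P hP
    by_cases h0 : P = pZero K q
    · rw [h0]
      exact (val_pZero_comb_le_iff c 0).2 hc
    · exact comb_mem_regularOutside c P (by simp_all)

theorem regularOutside_pZero : regularOutside {pZero K q} =
    (Finsupp.supported K K {i | poleInfty q i ≤ 0}).map (comb K q) := by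
  ext f
  rw [Submodule.mem_map]
  constructor
  · intro hf
    obtain ⟨c, rfl⟩ := exists_comb_eq (f := f) fun P hP => hf P fun h => hP (by simp_all)
    refine ⟨c, ?_, rfl⟩
    exact (val_pInfty_comb_le_iff c 0).1 (hf _ pInfty_ne_pZero)
  · rintro ⟨c, hc, rfl⟩ P hP
    by_cases h0 : P = pInfty K q
    · rw [h0]
      exact (val_pInfty_comb_le_iff c 0).2 hc
    · exact comb_mem_regularOutside c P (by simp_all)

variable (K q)

/-- All three spaces in the Čech quotient are spanned by monomials, so the quotient has as basis the
classes of the monomials regular at neither point. -/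
theorem genus_eq_ncard : genus K q = ({i | 0 < poleZero q i ∧ 0 < poleInfty q i} :
    Set (ℤ × Fin (q + 1))).ncard := by
  classical
  set S : Set (ℤ × Fin (q + 1)) := {i | poleZero q i ≤ 0} ∪ {i | poleInfty q i ≤ 0} with hS
  have hSc : {i | 0 < poleZero q i ∧ 0 < poleInfty q i} = Sᶜ := by
    ext i
    simp [hS]
  let e : (ℤ × Fin (q + 1) →₀ K) ≃ₗ[K] regularOutside {pInfty K q, pZero K q} :=
    LinearEquiv.ofBijective ((comb K q).codRestrict _ comb_mem_regularOutside)
      ⟨fun c d h => comb_injective (congrArg Subtype.val h), fun f => by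
        obtain ⟨c, hc⟩ := exists_comb_eq f.2
        exact ⟨c, Subtype.ext hc⟩⟩
  have he : (Finsupp.supported K K S).map (e : _ →ₗ[K] _) =
      (regularOutside {pInfty K q} ⊔ regularOutside {pZero K q}).comap
        (regularOutside {pInfty K q, pZero K q}).subtype := by
    rw [regularOutside_pInfty, regularOutside_pZero, ← Submodule.map_sup,
      ← Finsupp.supported_union]
    ext f
    rw [Submodule.mem_map, Submodule.mem_comap, Submodule.mem_map]
    exact exists_congr fun c => and_congr_right fun _ => Subtype.ext_iff
  have hcompl : IsCompl (Finsupp.supported K K S) (Finsupp.supported K K Sᶜ) := by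
    refine ⟨Finsupp.disjoint_supported_supported disjoint_compl_right, ?_⟩
    rw [codisjoint_iff, ← Finsupp.supported_union, Set.union_compl_self, Finsupp.supported_univ]
  rw [genus, cechGenus, ← (Submodule.Quotient.equiv _ _ e he).finrank_eq,
    (Submodule.quotientEquivOfIsCompl _ _ hcompl).finrank_eq,
    (Finsupp.supportedEquivFinsupp Sᶜ).finrank_eq, hSc, Module.finrank,
    rank_finsupp_self, Cardinal.toNat_lift, ← Nat.card, Set.ncard_def]
  rfl

/-- The Hermitian curve has genus `q (q - 1) / 2`. -/
theorem two_mul_genus : 2 * (genus K q : ℤ) = q * (q - 1) := by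
  -- For `m ≥ 1` there are `m - 1` exponents `n`, and none for `m = 0`; the total is `0 + 1 + ⋯ + (q
  -- - 1)`.
  have h : ({i | 0 < poleZero q i ∧ 0 < poleInfty q i} : Set (ℤ × Fin (q + 1))) =
      {i | 1 - ((i.2 : ℕ) : ℤ) ≤ i.1 ∧ i.1 ≤ -1} := by
    ext i
    simp only [Set.mem_ofPred_eq]
    rw [← not_le, poleZero_nonpos_iff, ← not_le, poleInfty_nonpos_iff]
    omega
  rw [genus_eq_ncard, h, ncard_setOf_fst_mem_Icc (fun m => 1 - m) (fun _ => -1),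
    Finset.sum_range_succ']
  have h2 : ∀ m : ℕ, (-1 + 1 - (1 - ((m + 1 : ℕ) : ℤ))).toNat = m := fun m => by omega
  simp only [h2]
  have h3 := Finset.sum_range_id_mul_two q
  have h4 : 1 ≤ q := (two_le K q).trans' one_le_two
  zify [h4] at h3
  push_cast
  simp
  linarith

end Hermitian

/-! ### Multiplicities as numbers of monomials -/

namespace Hermitian

variable {K : Type*} [Field K] {q : ℕ} [Finite K] [Fact (Nat.card K = q ^ 2)]

theorem twoPoint_apply_left {P Q : Place K (FunField K q)} (h : P ≠ Q) (a b : ℤ) :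
    twoPoint P a Q b P = a := by
  simp [twoPoint, h.symm]

theorem twoPoint_apply_right {P Q : Place K (FunField K q)} (h : P ≠ Q) (a b : ℤ) :
    twoPoint P a Q b Q = b := by
  simp [twoPoint, h]

theorem mem_riemannRoch_twoPoint_iff (a b : ℤ) (f : FunField K q) :
    f ∈ riemannRoch (twoPoint (pInfty K q) a (pZero K q) b) ↔
      f ∈ regularOutside {pInfty K q, pZero K q} ∧ (pInfty K q).val f ≤ WithZero.exp a ∧
        (pZero K q).val f ≤ WithZero.exp b := by
  have hne := pInfty_ne_pZero (K := K) (q := q)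
  change (f = 0 ∨ _) ↔ _
  rw [riemannRoch_mem_iff]
  constructor
  · intro h
    refine ⟨fun P hP => ?_, ?_, ?_⟩
    · simp only [Set.mem_insert_iff, Set.mem_singleton_iff, not_or] at hP
      simpa [twoPoint, Finsupp.single_apply, Ne.symm hP.1, Ne.symm hP.2] using h P
    · simpa only [twoPoint_apply_left hne] using h (pInfty K q)
    · simpa only [twoPoint_apply_right hne] using h (pZero K q)
  · rintro ⟨h, hI, h0⟩ P
    by_cases h1 : P = pInfty K q
    · rw [h1, twoPoint_apply_left hne]
      exact hI
    by_cases h2 : P = pZero K q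
    · rw [h2, twoPoint_apply_right hne]
      exact h0
    · simpa [twoPoint, Finsupp.single_apply, Ne.symm h1, Ne.symm h2] using h P (by simp [h1, h2])

theorem comb_mem_riemannRoch_iff (a b : ℤ) (c : ℤ × Fin (q + 1) →₀ K) :
    comb K q c ∈ riemannRoch (twoPoint (pInfty K q) a (pZero K q) b) ↔
      ∀ i ∈ c.support, poleInfty q i ≤ a ∧ poleZero q i ≤ b := by
  rw [mem_riemannRoch_twoPoint_iff, val_pInfty_comb_le_iff, val_pZero_comb_le_iff]
  exact ⟨fun h i hi => ⟨h.2.1 i hi, h.2.2 i hi⟩, fun h => ⟨comb_mem_regularOutside c,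
    fun i hi => (h i hi).1, fun i hi => (h i hi).2⟩⟩

theorem mon_mem_riemannRoch_iff (a b : ℤ) (i : ℤ × Fin (q + 1)) :
    mon K q i ∈ riemannRoch (twoPoint (pInfty K q) a (pZero K q) b) ↔
      poleInfty q i ≤ a ∧ poleZero q i ≤ b := by
  have h : mon K q i = comb K q (Finsupp.single i 1) := by simp [comb]
  rw [h, comb_mem_riemannRoch_iff, Finsupp.support_single _ one_ne_zero]
  simp

theorem ord_pInfty_mon (i : ℤ × Fin (q + 1)) : (pInfty K q).ord (mon K q i) = -poleInfty q i := by
  rw [Place.ord, val_pInfty_mon, WithZero.log_exp]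

/-- A function in `L(a P_∞ + b P_0)` has the pole order at `P_∞` of some monomial in this space. -/
theorem exists_mon_mem_riemannRoch {a b : ℤ} {f : FunField K q} (hf0 : f ≠ 0)
    (hf : f ∈ riemannRoch (twoPoint (pInfty K q) a (pZero K q) b)) :
    ∃ i, (pInfty K q).ord f = -poleInfty q i ∧ poleInfty q i ≤ a ∧ poleZero q i ≤ b := by
  obtain ⟨c, rfl⟩ := exists_comb_eq ((mem_riemannRoch_twoPoint_iff a b f).1 hf).1
  have hc : c ≠ 0 := by rintro rfl; simp at hf0
  obtain ⟨i, hi, hval, -⟩ := val_pInfty_comb hc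
  refine ⟨i, by rw [Place.ord, hval, WithZero.log_exp], (comb_mem_riemannRoch_iff a b c).1 hf i hi⟩

/-- Only the pole orders of the two factors at `P_∞` matter, and each is the pole order of a
monomial in the same Riemann-Roch space. Conversely, two monomials with the right total form an
admissible pair. -/
theorem multInfty_eq_ncard (a b : ℤ) : multInfty K q a b =
    ({i | poleZero q i ≤ b ∧ ∃ j, poleZero q j ≤ 0 ∧ poleInfty q i + poleInfty q j = a + 1} :
      Set (ℤ × Fin (q + 1))).ncard := by
  rw [multInfty, multiplicityAt, ← Set.ncard_image_of_injective _ (poleInfty_injective q)]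
  have hsingle : ∀ c : ℤ, (Finsupp.single (pInfty K q) c : Divisor K (FunField K q)) =
      twoPoint (pInfty K q) c (pZero K q) 0 := fun c => by simp [twoPoint]
  have hq := two_le K q
  congr 1
  ext k
  simp only [Set.mem_ofPred_eq, Set.mem_image, multPairs, hsingle]
  constructor
  · rintro ⟨-, -, f, g, ⟨h1, h2, h3, h4⟩, hk⟩
    have hfg : f * g ≠ 0 := fun h => h2 (h ▸ zero_mem _)
    obtain ⟨i, hi, -, hib⟩ := exists_mon_mem_riemannRoch (left_ne_zero_of_mul hfg) h3
    obtain ⟨j, hj, -, hj0⟩ := exists_mon_mem_riemannRoch (right_ne_zero_of_mul hfg) h4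
    have hik : poleInfty q i = k := by omega
    have hvf := (pInfty K q).val_ne_zero (left_ne_zero_of_mul hfg)
    have hvg := (pInfty K q).val_ne_zero (right_ne_zero_of_mul hfg)
    have hle : (pInfty K q).val (f * g) = WithZero.exp (poleInfty q i + poleInfty q j) := by
      rw [map_mul, ← WithZero.exp_log hvf, ← WithZero.exp_log hvg, ← WithZero.exp_add]
      congr 1
      rw [Place.ord] at hi hj
      omega
    refine ⟨i, ⟨hib, j, hj0, ?_⟩, hik⟩
    -- The two spaces differ only in the bound at `P_∞`, so the product has pole order exactly `a +
    -- 1` there.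
    rw [mem_riemannRoch_twoPoint_iff, hle, WithZero.exp_le_exp] at h1 h2
    by_contra hne
    exact h2 ⟨h1.1, by have := h1.2.1; omega, h1.2.2⟩
  · rintro ⟨i, ⟨hi, j, hj, hij⟩, rfl⟩
    have hj0 : 0 ≤ poleInfty q j := by
      rw [poleZero_nonpos_iff] at hj
      rw [poleInfty]
      positivity
    -- The range conditions on the pole order are automatic: the pole orders of `y ^ n * x ^ m` at
    -- the two points add up to `m (q - 1) ≥ 0`, and the second factor has nonnegative pole order at
    -- `P_∞`.
    have hi0 : -b ≤ poleInfty q i := by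
      have : (i.2 : ℕ) ≤ (i.2 : ℕ) * q := Nat.le_mul_of_pos_right _ (by omega)
      zify at this
      rw [poleZero] at hi
      rw [poleInfty]
      linarith
    have hI : (pInfty K q).val (mon K q i * mon K q j) = WithZero.exp (a + 1) := by
      rw [map_mul, val_pInfty_mon, val_pInfty_mon, ← WithZero.exp_add, hij]
    have h0 : (pZero K q).val (mon K q i * mon K q j) ≤ WithZero.exp b := by
      rw [map_mul, val_pZero_mon, val_pZero_mon, ← WithZero.exp_add, WithZero.exp_le_exp]
      omega
    have hreg : mon K q i * mon K q j ∈ regularOutside {pInfty K q, pZero K q} := by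
      intro P hP
      simp only [Set.mem_insert_iff, Set.mem_singleton_iff, not_or] at hP
      rw [map_mul]
      exact mul_le_one' (val_mon_le_one i hP.1 hP.2) (val_mon_le_one j hP.1 hP.2)
    refine ⟨hi0, by omega, mon K q i, mon K q j, ⟨?_, ?_, ?_, ?_⟩, ord_pInfty_mon i⟩
    · rw [mem_riemannRoch_twoPoint_iff]
      exact ⟨hreg, hI.le, h0⟩
    · rw [mem_riemannRoch_twoPoint_iff, hI, WithZero.exp_le_exp]
      omega
    · rw [mon_mem_riemannRoch_iff]
      omega
    · rw [mon_mem_riemannRoch_iff]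
      omega

/-- The involution `swap` exchanges the two multiplicities. -/
theorem multZero_eq_multInfty (a b : ℤ) : multZero K q a b = multInfty K q b a := by
  have hmem : ∀ (c d : ℤ) (f : FunField K q),
      swap K q f ∈ riemannRoch (twoPoint (pInfty K q) c (pZero K q) d) ↔
        f ∈ riemannRoch (twoPoint (pZero K q) c (pInfty K q) d) := by
    intro c d f
    change (_ ∨ _) ↔ (_ ∨ _)
    rw [riemannRoch_mem_iff, riemannRoch_mem_iff]
    have happ : ∀ P : Place K (FunField K q), twoPoint (pZero K q) c (pInfty K q) d (swapPlace P) =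
        twoPoint (pInfty K q) c (pZero K q) d P := by
      classical
      intro P
      have h1 : pZero K q = swapPlace P ↔ pInfty K q = P := by
        rw [← swapPlace_pInfty]
        exact (Function.LeftInverse.injective swapPlace_swapPlace).eq_iff
      have h2 : pInfty K q = swapPlace P ↔ pZero K q = P := by
        rw [← swapPlace_pZero]
        exact (Function.LeftInverse.injective swapPlace_swapPlace).eq_iff
      simp only [twoPoint, Finsupp.add_apply, Finsupp.single_apply, h1, h2]
    constructor
    · intro h P
      rw [← swapPlace_swapPlace P, happ]
      exact h (swapPlace P)
    · intro h P
      rw [← happ]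
      exact h (swapPlace P)
  have hsingle : ∀ (P Q : Place K (FunField K q)) (c : ℤ),
      (Finsupp.single P c : Divisor K (FunField K q)) = twoPoint P c Q 0 :=
    fun P Q c => by simp [twoPoint]
  have hord : ∀ f, (pInfty K q).ord (swap K q f) = (pZero K q).ord f := fun f => by
    rw [Place.ord, val_pInfty, swap_swap, Place.ord]
  have hsurj : Function.Surjective (swap K q) := fun f => ⟨swap K q f, swap_swap K q f⟩
  rw [multZero, multInfty, multiplicityAt, multiplicityAt]
  simp only [multPairs, Set.mem_ofPred_eq, hsingle (pZero K q) (pInfty K q),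
    hsingle (pInfty K q) (pZero K q), ← hmem, ← hord, map_mul]
  congr 1
  ext k
  refine and_congr_right fun _ => and_congr_right fun _ => ?_
  constructor
  · rintro ⟨f, g, h⟩
    exact ⟨_, _, h⟩
  · rintro ⟨f, g, h⟩
    obtain ⟨f, rfl⟩ := hsurj f
    obtain ⟨g, rfl⟩ := hsurj g
    exact ⟨_, _, h⟩

end Hermitian

/-! ### Counting the monomials for each exponent of `x` -/

namespace Hermitian

/-- The condition is `(n + b₀) (q + 1) + (m - b₁) ≥ 0` with `|m - b₁| ≤ q`, so only the sign of `m -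
b₁` matters. -/
theorem poleZero_le_iff {q : ℕ} (i : ℤ × Fin (q + 1)) {b₀ : ℤ} {b₁ : ℕ} (hb : b₁ ≤ q) :
    poleZero q i ≤ b₀ * (q + 1) - b₁ ↔
      (if (i.2 : ℕ) < b₁ then 1 - b₀ else -b₀) ≤ i.1 := by
  obtain ⟨n, m, hm⟩ := i
  have key : poleZero q (n, ⟨m, hm⟩) ≤ b₀ * (q + 1) - b₁ ↔ 0 ≤ (n + b₀) * (q + 1) + m - b₁ := by
    simp only [poleZero]
    constructor <;> intro h <;> linarith
  rw [key]
  simp only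
  split_ifs with h
  · constructor
    · intro h'
      by_contra! hn
      nlinarith
    · intro h'
      nlinarith
  · constructor
    · intro h'
      by_contra! hn
      nlinarith
    · intro h'
      nlinarith

/-- Since `q (q - 1) - 1 = (q - 2) (q + 1) + 1`, reduction modulo `q + 1` gives `m + m' ≡ a₁ - 1`.
As `0 ≤ m' ≤ q`, this forces `m' = a₁ - 1 - m` if `m < a₁` and `m' = a₁ + q - m` otherwise. Then
`n'` is determined, and `n' ≥ 0` is the stated bound on `n`. -/
theorem exists_poleInfty_add_eq_iff {q : ℕ} (i : ℤ × Fin (q + 1)) {a₀ : ℤ} {a₁ : ℕ}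
    (ha : a₁ ≤ q) :
    (∃ j, poleZero q j ≤ 0 ∧
      poleInfty q i + poleInfty q j = q * (q - 1) - 2 + (a₀ * (q + 1) - a₁) + 1) ↔
      i.1 ≤ if (i.2 : ℕ) < a₁ then q - 1 + a₀ - a₁ else a₀ - 1 - a₁ := by
  obtain ⟨n, m, hm⟩ := i
  simp only [poleZero_nonpos_iff, poleInfty]
  constructor
  · rintro ⟨⟨n', m', hm'⟩, hn', h⟩
    simp only at hn' h
    have h1 : (n + n' + m + m' - (q - 2) - a₀) * (q + 1) = (m : ℤ) + m' - a₁ + 1 := by linarith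
    have h2 : n + n' + m + m' - (q - 2) - a₀ < 2 := by
      by_contra! hlt
      nlinarith
    have h3 : -1 < n + n' + m + m' - (q - 2) - a₀ := by
      by_contra! hlt
      nlinarith
    obtain h4 | h4 : n + n' + m + m' - (q - 2) - a₀ = 0 ∨
        n + n' + m + m' - (q - 2) - a₀ = 1 := by omega
    all_goals
      rw [h4] at h1
      split_ifs <;> omega
  · intro h
    split_ifs at h with hma
    · refine ⟨(q - 1 + a₀ - a₁ - n, ⟨a₁ - 1 - m, by omega⟩), by simp only; omega, ?_⟩
      have : ((a₁ - 1 - m : ℕ) : ℤ) = a₁ - 1 - m := by omega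
      simp only [this]
      ring
    · refine ⟨(a₀ - 1 - a₁ - n, ⟨a₁ + q - m, by omega⟩), by simp only; omega, ?_⟩
      have : ((a₁ + q - m : ℕ) : ℤ) = a₁ + q - m := by omega
      simp only [this]
      ring

theorem sum_range_ite_lt {n k : ℕ} (h : k ≤ n) (t : ℤ) :
    ∑ m ∈ Finset.range n, (if m < k then t else 0) = k * t := by
  rw [← Finset.sum_filter, Finset.sum_const, nsmul_eq_mul]
  congr 2
  have : {m ∈ Finset.range n | m < k} = Finset.range k := by
    ext m
    simp only [Finset.mem_filter, Finset.mem_range]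
    omega
  rw [this, Finset.card_range]

variable (K : Type*) [Field K] {q : ℕ} [Finite K] [Fact (Nat.card K = q ^ 2)]

theorem multInfty_eq_sum {a₀ b₀ : ℤ} {a₁ b₁ : ℕ} (ha : a₁ ≤ q) (hb : b₁ ≤ q) :
    multInfty K q (2 * genus K q - 2 + (a₀ * (q + 1) - a₁)) (b₀ * (q + 1) - b₁) =
      ∑ m ∈ Finset.range (q + 1), ((if m < a₁ then q - 1 + a₀ - a₁ else a₀ - 1 - a₁) + 1 -
        (if m < b₁ then 1 - b₀ else -b₀)).toNat := by
  rw [multInfty_eq_ncard, two_mul_genus, ← ncard_setOf_fst_mem_Icc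
    (fun m => if m < b₁ then 1 - b₀ else -b₀)
    (fun m => if m < a₁ then q - 1 + a₀ - a₁ else a₀ - 1 - a₁)]
  congr 1
  ext i
  simp only [Set.mem_ofPred_eq, poleZero_le_iff i hb, exists_poleInfty_add_eq_iff i ha]

theorem multInfty_eq {a₀ b₀ : ℤ} {a₁ b₁ : ℕ} (ha : a₁ ≤ q) (hb : b₁ ≤ q) :
    (a₁ < a₀ + b₀ →
      (multInfty K q (2 * genus K q - 2 + (a₀ * (q + 1) - a₁)) (b₀ * (q + 1) - b₁) : ℤ) =
        (a₀ + b₀ - a₁) * (q + 1) - b₁ + a₁ * q) ∧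
    (a₀ + b₀ ≤ a₁ → a₁ ≤ a₀ + b₀ + q - 1 →
      (multInfty K q (2 * genus K q - 2 + (a₀ * (q + 1) - a₁)) (b₀ * (q + 1) - b₁) : ℤ) =
        a₁ * (q + (a₀ + b₀) - a₁) - min a₁ b₁) ∧
    (a₀ + b₀ + q - 1 < a₁ →
      multInfty K q (2 * genus K q - 2 + (a₀ * (q + 1) - a₁)) (b₀ * (q + 1) - b₁) = 0) := by
  rw [multInfty_eq_sum K ha hb]
  refine ⟨fun h => ?_, fun h h' => ?_, fun h => ?_⟩
  -- Every interval has length `a₀ + b₀ - a₁ + q [m < a₁] - [m < b₁]`; here `a₀ + b₀ - a₁ ≥ 1`, so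
  -- the truncation at `0` has no effect.
  · have hterm : ∀ m ∈ Finset.range (q + 1),
        ((((if m < a₁ then q - 1 + a₀ - a₁ else a₀ - 1 - a₁) + 1 -
          (if m < b₁ then 1 - b₀ else -b₀)).toNat : ℕ) : ℤ) =
        (a₀ + b₀ - a₁) + (if m < a₁ then (q : ℤ) else 0) - (if m < b₁ then 1 else 0) := by
      intro m _
      split_ifs <;> omega
    rw [Nat.cast_sum, Finset.sum_congr rfl hterm, Finset.sum_sub_distrib, Finset.sum_add_distrib,
      sum_range_ite_lt (by omega), sum_range_ite_lt (by omega), Finset.sum_const, Finset.card_range,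
      nsmul_eq_mul]
    push_cast
    ring
  -- Now the intervals with `m ≥ a₁` are empty, while those with `m < a₁` have length at least `0`.
  -- The correction for `m < b₁` survives only when also `m < a₁`, whence the minimum.
  · have hterm : ∀ m ∈ Finset.range (q + 1),
        ((((if m < a₁ then q - 1 + a₀ - a₁ else a₀ - 1 - a₁) + 1 -
          (if m < b₁ then 1 - b₀ else -b₀)).toNat : ℕ) : ℤ) =
        (if m < a₁ then q + (a₀ + b₀) - a₁ else 0) - (if m < min a₁ b₁ then 1 else 0) := by
      intro m _
      simp only [lt_min_iff]
      split_ifs <;> omega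
    rw [Nat.cast_sum, Finset.sum_congr rfl hterm, Finset.sum_sub_distrib,
      sum_range_ite_lt (by omega), sum_range_ite_lt (by omega), mul_one, Nat.cast_min]
  · refine Finset.sum_eq_zero fun m _ => ?_
    split_ifs <;> omega

end Hermitian

end

theorem proposition3p1 (K : Type*) [Field K] [Finite K] (q : ℕ) [Fact (Nat.card K = q ^ 2)]
    (g a b a₀ a₁ b₀ b₁ : ℤ) (hg : g = Hermitian.genus K q)
    (ha : a = a₀ * (q + 1) - a₁) (ha₁ : 0 ≤ a₁) (ha₁' : a₁ ≤ q)
    (hb : b = b₀ * (q + 1) - b₁) (hb₁ : 0 ≤ b₁) (hb₁' : b₁ ≤ q) :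
    (a₁ < a₀ + b₀ →
      (Hermitian.multInfty K q (2 * g - 2 + a) b : ℤ) =
        (a₀ + b₀ - a₁) * (q + 1) - b₁ + a₁ * q) ∧
    (a₀ + b₀ ≤ a₁ ∧ a₁ ≤ a₀ + b₀ + q - 1 →
      (Hermitian.multInfty K q (2 * g - 2 + a) b : ℤ) =
        a₁ * (q + a₀ + b₀ - a₁) - min a₁ b₁) ∧
    (a₀ + b₀ + q - 1 < a₁ →
      Hermitian.multInfty K q (2 * g - 2 + a) b = 0) ∧
    (b₁ < a₀ + b₀ →
      (Hermitian.multZero K q (2 * g - 2 + a) b : ℤ) =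
        (a₀ + b₀ - b₁) * (q + 1) - a₁ + b₁ * q) ∧
    (a₀ + b₀ ≤ b₁ ∧ b₁ ≤ a₀ + b₀ + q - 1 →
      (Hermitian.multZero K q (2 * g - 2 + a) b : ℤ) =
        b₁ * (q + a₀ + b₀ - b₁) - min a₁ b₁) ∧
    (a₀ + b₀ + q - 1 < b₁ →
      Hermitian.multZero K q (2 * g - 2 + a) b = 0) := by
  subst hg ha hb
  lift a₁ to ℕ using ha₁
  lift b₁ to ℕ using hb₁
  have ha' : a₁ ≤ q := by omega
  have hb' : b₁ ≤ q := by omega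
  have hg := Hermitian.two_mul_genus K q
  -- After the exchange of the two points, the canonical degree `2 g - 2 = (q - 2) (q + 1)` has to
  -- move to the other coefficient. This shifts `a₀` and `b₀` by `±(q - 2)` and leaves `a₀ + b₀`,
  -- `a₁` and `b₁` unchanged.
  have hzero : Hermitian.multZero K q (2 * Hermitian.genus K q - 2 + (a₀ * (q + 1) - a₁))
      (b₀ * (q + 1) - b₁) =
      Hermitian.multInfty K q (2 * Hermitian.genus K q - 2 + ((b₀ - (q - 2)) * (q + 1) - b₁))
        ((a₀ + (q - 2)) * (q + 1) - a₁) := by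
    rw [Hermitian.multZero_eq_multInfty, hg]
    congr 1 <;> ring
  have hsum : b₀ - (q - 2) + (a₀ + (q - 2)) = a₀ + b₀ := by ring
  obtain ⟨h1, h2, h3⟩ := Hermitian.multInfty_eq K (a₀ := a₀) (b₀ := b₀) ha' hb'
  obtain ⟨h4, h5, h6⟩ := Hermitian.multInfty_eq K (a₀ := b₀ - (q - 2)) (b₀ := a₀ + (q - 2)) hb' ha'
  rw [hsum] at h4 h5 h6
  rw [hzero]
  refine ⟨h1, fun h => ?_, h3, h4, fun h => ?_, h6⟩
  · rw [h2 h.1 (by linarith [h.2]), ← add_assoc, Nat.cast_min]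
  · rw [h5 h.1 (by linarith [h.2]), min_comm, ← add_assoc, Nat.cast_min]
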